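/- Let $\lambda>0$ and $\mu\ge 0$, and consider the Hadamard elastic material whose stored energy function is $\widehat w(\delta,\eta)=\mathcal W(\eta^{1/3},\delta/\eta)$, $\delta,\eta>0$, with \[ \mathcal W(x,y)=x^{-4}\Big((\lambda+\mu)y^{-2}+\tfrac12(\lambda+\mu)\Big)-(\lambda+2\mu)x^{-3}y^{-1}+x^{-2}\Big(-\tfrac12\lambda y^{-2}-\lambda\Big)+\tfrac12(2\lambda+\mu), \] so that its constitutive functions on $(0,\infty)^2$ are \[ \widehat p_{\rm rad}=\delta^2\,\partial_\delta\widehat w,\qquad \widehat p_{\rm tan}=\widehat p_{\rm rad}+\tfrac32\,\delta\eta\,\partial_\eta\widehat w . \] Given functions $\rho,p_{\rm rad},p_{\rm tan}:[0,\infty)\to\mathbb R$, put $m(r)=4\pi\int_0^r\rho(s)s^2\,ds$. The triple $(\rho,p_{\rm rad},p_{\rm tan})$ is a regular static self-gravitating ball of radius $R>0$ if $\mathrm{Int}\{r>0:\rho(r)>0\}=(0,R)$ and: (i) the three functions belong to $C^0([0,R])\cap C^1((0,R])$ and satisfy \[ p_{\rm rad}'(r)=-\frac2r\,(p_{\rm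 rad}-p_{\rm tan})-\rho\,\frac{m}{r^2},\qquad r\in(0,R); \] (ii) $p_{\rm rad},p_{\rm tan}>0$ on $[0,R)$; (iii) $p_{\rm rad}(R)=0$; (iv) $p_{\rm rad}(0)=p_{\rm tan}(0)$; (v) $\rho=p_{\rm rad}=p_{\rm tan}=0$ on $(R,\infty)$. It is strongly regular if moreover the three functions belong to $C^1([0,R])$ and their derivatives tend to $0$ as $r\to0^+$. It is a ball of the Hadamard material with reference density $\mathcal K>0$ if $p_{\rm rad}(r)=\widehat p_{\rm rad}(\delta(r),\eta(r))$ and $p_{\rm tan}(r)=\widehat p_{\rm tan}(\delta(r),\eta(r))$ for all $r>0$ with $\rho(r)>0$, where $\delta(r)=\rho(r)/\mathcal K$ and $\eta(r)=m(r)/(\frac{4\pi}{3}\mathcal K r^3)$. Then: (a) Every regular static self-gravitating ball of the Hadamard material with reference density $\mathcal K$ satisfies $\rho(0)/\mathcal K>1$. (b) Let $\mathcal K>0$ and let $\rho_c$ be such that $\delta_c:=\rho_c/\mathcal K$ satisfies \[ 1<\delta_c<\Delta_\sharp:=\Big(\frac{\lambda+\mu}{\lambda}\Big)^{3/2}. \]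 Then $\partial_\delta\widehat p_{\rm rad}(\delta_c,\delta_c)>0$, and there is exactly one regular static self-gravitating ball of the Hadamard material with reference density $\mathcal K$ and central density $\rho(0)=\rho_c$; this ball is strongly regular (in particular, it is the unique strongly regular one). Moreover, if $R$ is its radius, then for all $r\in(0,R]$ one has $\rho(r)>0$ and \[ \partial_\delta\widehat p_{\rm rad}(\delta(r),\eta(r))>0,\qquad \rho(r)<\rho_c,\qquad \frac{4\pi}{3}\max(\rho(r),\mathcal K)\,r^3<m(r)<\frac{4\pi}{3}\rho_c\,r^3 . \] -/

import Mathlib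

open Set Filter Topology

noncomputable section

/-- The mass `m(r) = 4π ∫₀ʳ ρ(s) s² ds` enclosed in the ball of radius `r`. -/
def enclosedMass (ρ : ℝ → ℝ) (r : ℝ) : ℝ :=
  4 * Real.pi * ∫ s in (0 : ℝ)..r, ρ s * s ^ 2

/-- `(ρ, prad, ptan)` is a regular static self-gravitating ball of matter of radius `R`.
Only the values of the three functions on `[0, ∞)` matter. Regularity at the boundary point `R`
is one-sided, since the profiles may jump to `0` there. -/
structure IsRegularBall (ρ prad ptan : ℝ → ℝ) (R : ℝ) : Prop where
  radius_pos : 0 < R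
  support : interior {r : ℝ | 0 < r ∧ 0 < ρ r} = Ioo 0 R
  cont_rho : ContinuousOn ρ (Icc 0 R)
  cont_prad : ContinuousOn prad (Icc 0 R)
  cont_ptan : ContinuousOn ptan (Icc 0 R)
  contDiff_rho : ContDiffOn ℝ 1 ρ (Ioc 0 R)
  contDiff_prad : ContDiffOn ℝ 1 prad (Ioc 0 R)
  contDiff_ptan : ContDiffOn ℝ 1 ptan (Ioc 0 R)
  /-- Hydrostatic equilibrium `prad' = -(2/r)(prad - ptan) - ρ Φ'`, where the Newtonian potential
  satisfies `Φ' = m / r²`. -/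
  equilibrium : ∀ r ∈ Ioo 0 R,
    HasDerivAt prad (-(2 / r) * (prad r - ptan r) - ρ r * (enclosedMass ρ r / r ^ 2)) r
  prad_pos : ∀ r ∈ Ico 0 R, 0 < prad r
  ptan_pos : ∀ r ∈ Ico 0 R, 0 < ptan r
  prad_boundary : prad R = 0
  isotropic_center : prad 0 = ptan 0
  rho_vacuum : ∀ r, R < r → ρ r = 0
  prad_vacuum : ∀ r, R < r → prad r = 0
  ptan_vacuum : ∀ r, R < r → ptan r = 0

/-- A regular ball is strongly regular if the profiles are `C¹` up to the center and their
derivatives vanish there. -/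
structure IsStronglyRegularBall (ρ prad ptan : ℝ → ℝ) (R : ℝ) : Prop
    extends IsRegularBall ρ prad ptan R where
  contDiff_rho_center : ContDiffOn ℝ 1 ρ (Icc 0 R)
  contDiff_prad_center : ContDiffOn ℝ 1 prad (Icc 0 R)
  contDiff_ptan_center : ContDiffOn ℝ 1 ptan (Icc 0 R)
  deriv_rho_center : Tendsto (deriv ρ) (𝓝[>] 0) (𝓝 0)
  deriv_prad_center : Tendsto (deriv prad) (𝓝[>] 0) (𝓝 0)
  deriv_ptan_center : Tendsto (deriv ptan) (𝓝[>] 0) (𝓝 0)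

/-- The compression `δ(r) = ρ(r) / K` relative to the reference density `K`. -/
def relDensity (K : ℝ) (ρ : ℝ → ℝ) (r : ℝ) : ℝ := ρ r / K

/-- The mean compression `η(r) = m(r) / ((4π/3) K r³)`. -/
def meanRelDensity (K : ℝ) (ρ : ℝ → ℝ) (r : ℝ) : ℝ :=
  enclosedMass ρ r / (4 * Real.pi / 3 * K * r ^ 3)

/-- The pressures are given by `C¹` constitutive functions `phrad, phtan` on `(0, ∞)²` with
reference density `K`, wherever there is matter. -/
structure HasElasticPressures (K : ℝ) (phrad phtan : ℝ → ℝ → ℝ) (ρ prad ptan : ℝ → ℝ) : Prop where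
  refDensity_pos : 0 < K
  contDiff_rad : ContDiffOn ℝ 1 (fun q : ℝ × ℝ => phrad q.1 q.2) (Ioi 0 ×ˢ Ioi 0)
  contDiff_tan : ContDiffOn ℝ 1 (fun q : ℝ × ℝ => phtan q.1 q.2) (Ioi 0 ×ˢ Ioi 0)
  rad_eq : ∀ r, 0 < r → 0 < ρ r → prad r = phrad (relDensity K ρ r) (meanRelDensity K ρ r)
  tan_eq : ∀ r, 0 < r → 0 < ρ r → ptan r = phtan (relDensity K ρ r) (meanRelDensity K ρ r)

/-- Regular static self-gravitating elastic ball of radius `R` with reference density `K` and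
constitutive functions `phrad, phtan`. -/
def IsRegularElasticBall (K : ℝ) (phrad phtan : ℝ → ℝ → ℝ)
    (ρ prad ptan : ℝ → ℝ) (R : ℝ) : Prop :=
  IsRegularBall ρ prad ptan R ∧ HasElasticPressures K phrad phtan ρ prad ptan

/-- Strongly regular static self-gravitating elastic ball. -/
def IsStronglyRegularElasticBall (K : ℝ) (phrad phtan : ℝ → ℝ → ℝ)
    (ρ prad ptan : ℝ → ℝ) (R : ℝ) : Prop :=
  IsStronglyRegularBall ρ prad ptan R ∧ HasElasticPressures K phrad phtan ρ prad ptan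

/-- Radial constitutive function of a hyperelastic material: `δ² ∂_δ w`. -/
def hyperelasticRad (w : ℝ → ℝ → ℝ) (δ η : ℝ) : ℝ :=
  δ ^ 2 * deriv (fun d => w d η) δ

/-- Tangential constitutive function of a hyperelastic material: `prad + (3/2) δ η ∂_η w`. -/
def hyperelasticTan (w : ℝ → ℝ → ℝ) (δ η : ℝ) : ℝ :=
  hyperelasticRad w δ η + 3 / 2 * δ * η * deriv (fun e => w δ e) η

/-- Hadamard stored energy (case `k = 1/2`) in the variables `x = η^(1/3)`, `y = δ / η`. -/
def hadamardW (lam mu x y : ℝ) : ℝ :=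
  (x ^ 4)⁻¹ * ((lam + mu) * (y ^ 2)⁻¹ + 1 / 2 * (lam + mu))
    - (lam + 2 * mu) * (x ^ 3)⁻¹ * y⁻¹
    + (x ^ 2)⁻¹ * (-(1 / 2) * lam * (y ^ 2)⁻¹ - lam)
    + 1 / 2 * (2 * lam + mu)

/-- Hadamard stored energy as a function of `(δ, η)`. -/
def hadamardEnergy (lam mu δ η : ℝ) : ℝ :=
  hadamardW lam mu (η ^ (1 / 3 : ℝ)) (δ / η)

/-- Radial constitutive function of the Hadamard material. -/
def hadamardRad (lam mu : ℝ) : ℝ → ℝ → ℝ := hyperelasticRad (hadamardEnergy lam mu)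

/-- Tangential constitutive function of the Hadamard material. -/
def hadamardTan (lam mu : ℝ) : ℝ → ℝ → ℝ := hyperelasticTan (hadamardEnergy lam mu)

end

noncomputable section

/-! Write `h` for `radProfile` and `g` for `shearProfile`. In closed form the pressures are `p_rad =
λ + 2μ - h(η)/δ` and `p_tan - p_rad = g(η) (1/δ - δ/η²)`, with `h' = 4g/(3η)`. Since `η' = 3(δ -
η)/r`, hydrostatic equilibrium can be solved for `δ'`. The anisotropy and the `η`-dependence of the
pressure combine into a perfect square, `δ' = -2 g δ (δ - η)² / (h η² r) - r κ δ³ η / h`, where `κ =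
4πK²/3`. Below `Δ_♯` both `g` and `h` are positive, so the density decreases.

For (a), if `ρ(0)` were zero, the limits of `p_rad` and of `p_tan - p_rad` at the center would be
incompatible (`rho_zero_pos`). Hence `p_rad(0)` is the diagonal value of the constitutive law, and
this is positive only for central compression above 1.

For uniqueness in (b), monotonicity keeps `η` subcritical. Together with `p_rad > 0` it confines
every ball to `minDensity ≤ δ ≤ η ≤ δ_c`, `η ≥ 1`, with `minDensity > 0` (`isStructureFlow`). Two
solutions with the same center satisfy a Gronwall estimate for `e² + q²`, where `e` and `q` are the
differences of `η` and of `(δ - η)/r`. The singular term in `q'` has a favourable sign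
(`IsStructureFlow.eqOn`). The radius is fixed because the pressure vanishes at the boundary only.

For existence, `v = (δ - η)/r²` turns the system into `r v' = -5v - (B v + F)` with `B ∈ [-1/2, 0]`
and `F > 0`. The damping 5 dominates `B`, so the integrated equation is a contraction in an
exponentially weighted norm (`exists_singular_ivp`). With truncated coefficients the solution exists
until `δ` is negative. The pressure must vanish earlier, and up to its first zero `R` no truncation
is active (`exists_isBallProfile`). -/

/-- The function `h` with `p_rad(δ, η) = λ + 2μ - h(η) / δ`. -/
def radProfile (lam mu η : ℝ) : ℝ :=
  2 * (lam + mu) * η ^ (2 / 3 : ℝ) - lam * η ^ (4 / 3 : ℝ)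

/-- The function `g` with `p_tan - p_rad = g(η) (1 / δ - δ / η²)`. -/
def shearProfile (lam mu η : ℝ) : ℝ :=
  (lam + mu) * η ^ (2 / 3 : ℝ) - lam * η ^ (4 / 3 : ℝ)

/-- Closed form of the radial constitutive function. -/
def radPressure (lam mu δ η : ℝ) : ℝ := lam + 2 * mu - radProfile lam mu η / δ

/-- Closed form of the tangential constitutive function. -/
def tanPressure (lam mu δ η : ℝ) : ℝ :=
  radPressure lam mu δ η + shearProfile lam mu η * (1 / δ - δ / η ^ 2)

/-! ### Closed form and signs of the constitutive functions. -/

section Constitutive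

variable {lam mu δ η : ℝ}

/-- Separating the powers of `δ` and `η` allows termwise differentiation in either variable. -/
lemma hadamardEnergy_eq (hδ : δ ≠ 0) (hη : 0 < η) :
    hadamardEnergy lam mu δ η =
      (lam + mu) * η ^ (2 / 3 : ℝ) / δ ^ 2 + 1 / 2 * (lam + mu) * η ^ (-4 / 3 : ℝ)
        - (lam + 2 * mu) / δ - 1 / 2 * lam * η ^ (4 / 3 : ℝ) / δ ^ 2
        - lam * η ^ (-2 / 3 : ℝ) + 1 / 2 * (2 * lam + mu) := by
  have e4 : (η ^ (1 / 3 : ℝ)) ^ 4 = η ^ (4 / 3 : ℝ) := by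
    rw [← Real.rpow_mul_natCast hη.le]; norm_num
  have e3 : (η ^ (1 / 3 : ℝ)) ^ 3 = η := by
    rw [← Real.rpow_mul_natCast hη.le]; norm_num
  have e2 : (η ^ (1 / 3 : ℝ)) ^ 2 = η ^ (2 / 3 : ℝ) := by
    rw [← Real.rpow_mul_natCast hη.le]; norm_num
  have n4 : η ^ (-4 / 3 : ℝ) = (η ^ (4 / 3 : ℝ))⁻¹ := by
    rw [← Real.rpow_neg hη.le]; norm_num
  have n2 : η ^ (-2 / 3 : ℝ) = (η ^ (2 / 3 : ℝ))⁻¹ := by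
    rw [← Real.rpow_neg hη.le]; norm_num
  have s2 : η ^ (4 / 3 : ℝ) = (η ^ (2 / 3 : ℝ)) ^ 2 := by
    rw [← Real.rpow_mul_natCast hη.le]; norm_num
  have s3 : η ^ 2 = (η ^ (2 / 3 : ℝ)) ^ 3 := by
    rw [← Real.rpow_mul_natCast hη.le]; norm_num
  have hp : 0 < η ^ (2 / 3 : ℝ) := Real.rpow_pos_of_pos hη _
  unfold hadamardEnergy hadamardW
  rw [e4, e3, e2, n4, n2, s2, div_pow, inv_div, inv_div, s3]
  field_simp
  ring

lemma hasDerivAt_hadamardEnergy_fst (hδ : 0 < δ) (hη : 0 < η) :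
    HasDerivAt (fun d => hadamardEnergy lam mu d η)
      (radPressure lam mu δ η / δ ^ 2) δ := by
  have h1 : HasDerivAt (fun d : ℝ => 1 / d ^ 2) (-2 / δ ^ 3) δ := by
    refine ((hasDerivAt_const δ (1 : ℝ)).div (hasDerivAt_pow 2 δ)
      (pow_ne_zero 2 hδ.ne')).congr_deriv ?_
    field_simp
    norm_num
    ring
  have h2 : HasDerivAt (fun d : ℝ => 1 / d) (-1 / δ ^ 2) δ := by
    refine ((hasDerivAt_const δ (1 : ℝ)).div (hasDerivAt_id δ) hδ.ne').congr_deriv ?_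
    simp
  have key := ((h1.const_mul ((lam + mu) * η ^ (2 / 3 : ℝ) - 1 / 2 * lam * η ^ (4 / 3 : ℝ))).sub
    (h2.const_mul (lam + 2 * mu))).add_const
    (1 / 2 * (lam + mu) * η ^ (-4 / 3 : ℝ) - lam * η ^ (-2 / 3 : ℝ) + 1 / 2 * (2 * lam + mu))
  refine (key.congr_of_eventuallyEq ?_).congr_deriv ?_
  · filter_upwards [lt_mem_nhds hδ] with d hd
    rw [hadamardEnergy_eq hd.ne' hη]
    simp only [Pi.sub_apply]
    ring
  · unfold radPressure radProfile
    field_simp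
    ring

lemma hadamardRad_eq (hδ : 0 < δ) (hη : 0 < η) :
    hadamardRad lam mu δ η = radPressure lam mu δ η := by
  unfold hadamardRad hyperelasticRad
  rw [(hasDerivAt_hadamardEnergy_fst hδ hη).deriv]
  field_simp

lemma hasDerivAt_hadamardEnergy_snd (hδ : 0 < δ) (hη : 0 < η) :
    HasDerivAt (fun e => hadamardEnergy lam mu δ e)
      (2 / 3 * shearProfile lam mu η * (1 / δ - δ / η ^ 2) / (δ * η)) η := by
  have hp (p : ℝ) := Real.hasDerivAt_rpow_const (x := η) (p := p) (Or.inl hη.ne')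
  have key := ((((hp (2 / 3)).const_mul ((lam + mu) / δ ^ 2)).add
    ((hp (-4 / 3)).const_mul (1 / 2 * (lam + mu)))).sub
    ((hp (4 / 3)).const_mul (1 / 2 * lam / δ ^ 2))).sub ((hp (-2 / 3)).const_mul lam)
    |>.add_const (1 / 2 * (2 * lam + mu) - (lam + 2 * mu) / δ)
  refine (key.congr_of_eventuallyEq ?_).congr_deriv ?_
  · filter_upwards [lt_mem_nhds hη] with e he
    rw [hadamardEnergy_eq hδ.ne' he]
    simp only [Pi.sub_apply, Pi.add_apply]
    ring
  · have e1 : η ^ (2 / 3 - 1 : ℝ) = η ^ (2 / 3 : ℝ) / η := by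
      rw [Real.rpow_sub_one hη.ne']
    have e2 : η ^ (4 / 3 - 1 : ℝ) = η ^ (4 / 3 : ℝ) / η := by
      rw [Real.rpow_sub_one hη.ne']
    have e3 : η ^ (-4 / 3 - 1 : ℝ) = η ^ (2 / 3 : ℝ) / η ^ 3 := by
      rw [← Real.rpow_natCast η 3, ← Real.rpow_sub hη]; norm_num
    have e4 : η ^ (-2 / 3 - 1 : ℝ) = η ^ (4 / 3 : ℝ) / η ^ 3 := by
      rw [← Real.rpow_natCast η 3, ← Real.rpow_sub hη]; norm_num
    rw [e1, e2, e3, e4]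
    unfold shearProfile
    field_simp
    ring

lemma hadamardTan_eq (hδ : 0 < δ) (hη : 0 < η) :
    hadamardTan lam mu δ η = tanPressure lam mu δ η := by
  have h := hadamardRad_eq (lam := lam) (mu := mu) hδ hη
  unfold hadamardRad at h
  unfold hadamardTan hyperelasticTan tanPressure
  rw [h, (hasDerivAt_hadamardEnergy_snd hδ hη).deriv]
  field_simp

lemma hasDerivAt_hadamardRad_fst (hδ : 0 < δ) (hη : 0 < η) :
    HasDerivAt (fun d => hadamardRad lam mu d η) (radProfile lam mu η / δ ^ 2) δ := by
  have key := ((hasDerivAt_inv hδ.ne').const_mul (radProfile lam mu η)).const_sub (lam + 2 * mu)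
  refine (key.congr_of_eventuallyEq ?_).congr_deriv (by field_simp)
  filter_upwards [lt_mem_nhds hδ] with d hd
  rw [hadamardRad_eq hd hη, radPressure, div_eq_mul_inv]

lemma contDiffAt_radProfile (hη : 0 < η) : ContDiffAt ℝ 1 (radProfile lam mu) η := by
  unfold radProfile
  exact (contDiffAt_const.mul (Real.contDiffAt_rpow_const_of_ne hη.ne')).sub
    (contDiffAt_const.mul (Real.contDiffAt_rpow_const_of_ne hη.ne'))

lemma contDiffAt_shearProfile (hη : 0 < η) : ContDiffAt ℝ 1 (shearProfile lam mu) η := by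
  unfold shearProfile
  exact (contDiffAt_const.mul (Real.contDiffAt_rpow_const_of_ne hη.ne')).sub
    (contDiffAt_const.mul (Real.contDiffAt_rpow_const_of_ne hη.ne'))

lemma contDiffAt_radPressure {q : ℝ × ℝ} (h1 : 0 < q.1) (h2 : 0 < q.2) :
    ContDiffAt ℝ 1 (fun q : ℝ × ℝ => radPressure lam mu q.1 q.2) q := by
  unfold radPressure
  exact contDiffAt_const.sub
    (((contDiffAt_radProfile h2).comp q contDiffAt_snd).div contDiffAt_fst h1.ne')

lemma contDiffAt_tanPressure {q : ℝ × ℝ} (h1 : 0 < q.1) (h2 : 0 < q.2) :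
    ContDiffAt ℝ 1 (fun q : ℝ × ℝ => tanPressure lam mu q.1 q.2) q := by
  unfold tanPressure
  exact (contDiffAt_radPressure h1 h2).add
    (((contDiffAt_shearProfile h2).comp q contDiffAt_snd).mul
      ((contDiffAt_const.div contDiffAt_fst h1.ne').sub
        (contDiffAt_fst.div (contDiffAt_snd.pow 2) (pow_pos h2 2).ne')))

lemma contDiffOn_hadamardRad :
    ContDiffOn ℝ 1 (fun q : ℝ × ℝ => hadamardRad lam mu q.1 q.2) (Ioi 0 ×ˢ Ioi 0) :=
  ContDiffOn.congr (fun _ hq => (contDiffAt_radPressure hq.1 hq.2).contDiffWithinAt)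
    fun _ hq => hadamardRad_eq hq.1 hq.2

lemma contDiffOn_hadamardTan :
    ContDiffOn ℝ 1 (fun q : ℝ × ℝ => hadamardTan lam mu q.1 q.2) (Ioi 0 ×ˢ Ioi 0) :=
  ContDiffOn.congr (fun _ hq => (contDiffAt_tanPressure hq.1 hq.2).contDiffWithinAt)
    fun _ hq => hadamardTan_eq hq.1 hq.2

lemma tanPressure_self (hη : 0 < η) : tanPressure lam mu η η = radPressure lam mu η η := by
  unfold tanPressure
  have : 1 / η - η / η ^ 2 = 0 := by field_simp; ring
  rw [this]; ring

lemma radProfile_one : radProfile lam mu 1 = lam + 2 * mu := by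
  unfold radProfile; norm_num; ring

lemma hasDerivAt_radProfile (hη : 0 < η) :
    HasDerivAt (radProfile lam mu) (4 / 3 * shearProfile lam mu η / η) η := by
  have hp (p : ℝ) := Real.hasDerivAt_rpow_const (x := η) (p := p) (Or.inl hη.ne')
  refine (((hp (2 / 3)).const_mul (2 * (lam + mu))).sub
    ((hp (4 / 3)).const_mul lam)).congr_deriv ?_
  rw [Real.rpow_sub_one hη.ne', Real.rpow_sub_one hη.ne']
  unfold shearProfile
  ring

/-- On the diagonal the pressure has the sign of `η - 1`. -/
lemma radProfile_lt_iff (hlam : 0 < lam) (hmu : 0 ≤ mu) (hη : 0 < η) :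
    radProfile lam mu η < (lam + 2 * mu) * η ↔ 1 < η := by
  set u := η ^ (1 / 3 : ℝ) with hu
  have hu0 : 0 < u := Real.rpow_pos_of_pos hη _
  have e3 : η = u ^ 3 := by rw [hu, ← Real.rpow_mul_natCast hη.le]; norm_num
  have e2 : η ^ (2 / 3 : ℝ) = u ^ 2 := by rw [hu, ← Real.rpow_mul_natCast hη.le]; norm_num
  have e4 : η ^ (4 / 3 : ℝ) = u ^ 4 := by rw [hu, ← Real.rpow_mul_natCast hη.le]; norm_num
  have h1 : (1 < η) ↔ 1 < u := by
    rw [e3]; exact one_lt_pow_iff_of_nonneg hu0.le (by norm_num)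
  rw [h1]
  unfold radProfile
  rw [e2, e4, e3]
  have key : (lam + 2 * mu) * u ^ 3 - (2 * (lam + mu) * u ^ 2 - lam * u ^ 4)
      = u ^ 2 * (lam * u + 2 * (lam + mu)) * (u - 1) := by ring
  have hpos : 0 < u ^ 2 * (lam * u + 2 * (lam + mu)) := by positivity
  rw [← sub_pos, key, mul_pos_iff_of_pos_left hpos, sub_pos]

lemma radPressure_self_pos_iff (hlam : 0 < lam) (hmu : 0 ≤ mu) (hη : 0 < η) :
    0 < radPressure lam mu η η ↔ 1 < η := by
  rw [← radProfile_lt_iff hlam hmu hη, radPressure, sub_pos, div_lt_iff₀ hη]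

/-- The critical density `Δ_♯`. -/
def criticalDensity (lam mu : ℝ) : ℝ := ((lam + mu) / lam) ^ (3 / 2 : ℝ)

/-- The factorization `g = η^(2/3) ((λ + μ) - λ η^(2/3))` shows that the critical density is exactly
the zero of `g`. -/
lemma shearProfile_pos (hlam : 0 < lam) (hmu : 0 ≤ mu) (hη : 0 < η)
    (hc : η < criticalDensity lam mu) : 0 < shearProfile lam mu η := by
  have hq : 0 < (lam + mu) / lam := by positivity
  have h1 : η ^ (2 / 3 : ℝ) < (lam + mu) / lam := by
    have := Real.rpow_lt_rpow hη.le hc (by norm_num : (0 : ℝ) < 2 / 3)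
    rwa [criticalDensity, ← Real.rpow_mul hq.le, show (3 / 2 : ℝ) * (2 / 3) = 1 by norm_num,
      Real.rpow_one] at this
  rw [lt_div_iff₀ hlam] at h1
  have s2 : η ^ (4 / 3 : ℝ) = (η ^ (2 / 3 : ℝ)) ^ 2 := by
    rw [← Real.rpow_mul_natCast hη.le]; norm_num
  have hp : 0 < η ^ (2 / 3 : ℝ) := Real.rpow_pos_of_pos hη _
  unfold shearProfile
  rw [s2]
  nlinarith

lemma radProfile_eq_add : radProfile lam mu η =
    shearProfile lam mu η + (lam + mu) * η ^ (2 / 3 : ℝ) := by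
  unfold radProfile shearProfile; ring

lemma shearProfile_lt_radProfile (hlam : 0 < lam) (hmu : 0 ≤ mu) (hη : 0 < η) :
    shearProfile lam mu η < radProfile lam mu η := by
  rw [radProfile_eq_add]
  have hp : 0 < η ^ (2 / 3 : ℝ) := Real.rpow_pos_of_pos hη _
  have : 0 < (lam + mu) * η ^ (2 / 3 : ℝ) := by positivity
  linarith

lemma radProfile_pos (hlam : 0 < lam) (hmu : 0 ≤ mu) (hη : 0 < η)
    (hc : η < criticalDensity lam mu) : 0 < radProfile lam mu η :=
  (shearProfile_pos hlam hmu hη hc).trans (shearProfile_lt_radProfile hlam hmu hη)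

/-- Nonnegative radial pressure means `(λ + 2μ) δ ≥ h(η)`, so this bound keeps the density away from
zero up to the boundary; it is the source of `minDensity`. -/
lemma lt_radProfile (hlam : 0 < lam) (hmu : 0 ≤ mu) (hη : 1 ≤ η)
    (hc : η < criticalDensity lam mu) : lam + mu < radProfile lam mu η := by
  rw [radProfile_eq_add]
  have h0 := shearProfile_pos hlam hmu (by linarith) hc
  have hp : 1 ≤ η ^ (2 / 3 : ℝ) := Real.one_le_rpow hη (by norm_num)
  nlinarith

end Constitutive

/-! ### Hydrostatic equilibrium solved for the derivative of the density. -/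

section Equilibrium

/-- The coefficient of `-(δ - η) / r` in the equation for `δ'`. -/
def shearCoeff (lam mu δ η : ℝ) : ℝ :=
  2 * shearProfile lam mu η * δ * (δ - η) / (radProfile lam mu η * η ^ 2)

/-- The gravitational term in the equation for `δ'`. -/
def gravityCoeff (lam mu κ δ η : ℝ) : ℝ := κ * δ ^ 3 * η / radProfile lam mu η

variable {lam mu κ r δ' : ℝ} {δ η : ℝ → ℝ}

lemma hasDerivAt_radPressure_comp (hδ : 0 < δ r) (hη : 0 < η r) (h1 : HasDerivAt δ δ' r)
    (h2 : HasDerivAt η (3 * (δ r - η r) / r) r) :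
    HasDerivAt (fun s => radPressure lam mu (δ s) (η s))
      (radProfile lam mu (η r) * δ' / δ r ^ 2
        - 4 * shearProfile lam mu (η r) * (δ r - η r) / (η r * r * δ r)) r := by
  have h3 := (hasDerivAt_radProfile (lam := lam) (mu := mu) hη).comp r h2
  refine ((h3.div h1 hδ.ne').const_sub (lam + 2 * mu)).congr_deriv ?_
  simp only [Function.comp]
  -- At `r = 0` all quotients by `r` are zero by convention, so the identity persists there.
  by_cases hr : r = 0
  · subst hr; field_simp; simp
  · field_simp
    ring

/-- The two terms containing `g` have common factor `2g(δ - η)/(r δ η²)`; what remains is `-(δ + η)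
+ 2η = -(δ - η)`, which produces a square. The coefficient `h/δ²` of `δ'` is nonzero, so the two
equations are equivalent. -/
lemma equilibrium_iff (hr : 0 < r) {d e : ℝ} (hδ : 0 < d) (hη : 0 < e)
    (hh : 0 < radProfile lam mu e) :
    radProfile lam mu e * δ' / d ^ 2 - 4 * shearProfile lam mu e * (d - e) / (e * r * d) =
      -(2 / r) * (radPressure lam mu d e - tanPressure lam mu d e) - κ * d * e * r ↔
    δ' = -(shearCoeff lam mu d e * (d - e) / r) - r * gravityCoeff lam mu κ d e := by
  unfold tanPressure shearCoeff gravityCoeff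
  set h := radProfile lam mu e
  set g := shearProfile lam mu e
  set P := radPressure lam mu d e
  have hd2 : (0 : ℝ) < h / d ^ 2 := by positivity
  rw [← sub_eq_zero, ← sub_eq_zero (a := δ')]
  have key : (h * δ' / d ^ 2 - 4 * g * (d - e) / (e * r * d)
      - (-(2 / r) * (P - (P + g * (1 / d - d / e ^ 2))) - κ * d * e * r)) =
      h / d ^ 2 * (δ' - (-(2 * g * d * (d - e) / (h * e ^ 2) * (d - e) / r)
        - r * (κ * d ^ 3 * e / h))) := by
    field_simp
    ring
  rw [key, mul_eq_zero, or_iff_right hd2.ne']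

end Equilibrium

/-! ### A contraction argument for initial value problems singular at the center. -/

section SingularIVP

/-- Extension of a function on `[0, T]` to the line, multiplied by the weight `exp (N r)`. -/
def weightedExtend {T : ℝ} (hT : 0 ≤ T) (N : ℝ) (w : C(Icc (0 : ℝ) T, ℝ)) (r : ℝ) : ℝ :=
  Real.exp (N * r) * w (projIcc 0 T hT r)

lemma continuous_weightedExtend {T : ℝ} (hT : 0 ≤ T) (N : ℝ) (w : C(Icc (0 : ℝ) T, ℝ)) :
    Continuous (weightedExtend hT N w) := by
  unfold weightedExtend
  exact (by fun_prop : Continuous fun r : ℝ => Real.exp (N * r)).mul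
    (w.continuous.comp continuous_projIcc)

lemma abs_weightedExtend_sub_le {T : ℝ} (hT : 0 ≤ T) (N : ℝ) (w w' : C(Icc (0 : ℝ) T, ℝ))
    (r : ℝ) : |weightedExtend hT N w r - weightedExtend hT N w' r| ≤
      Real.exp (N * r) * dist w w' := by
  unfold weightedExtend
  rw [← mul_sub, abs_mul, abs_of_pos (Real.exp_pos _)]
  gcongr
  rw [← Real.dist_eq]
  exact ContinuousMap.dist_apply_le_dist _

lemma integral_mul_exp_neg {N r : ℝ} (hN : 0 < N) :
    ∫ τ in (0 : ℝ)..1, r * Real.exp (-(N * r * (1 - τ))) = (1 - Real.exp (-(N * r))) / N := by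
  have h : ∀ τ ∈ uIcc (0 : ℝ) 1, HasDerivAt (fun τ => Real.exp (-(N * r * (1 - τ))) / N)
      (r * Real.exp (-(N * r * (1 - τ)))) τ := by
    intro τ _
    have h1 : HasDerivAt (fun τ : ℝ => -(N * r * (1 - τ))) (N * r) τ := by
      refine ((((hasDerivAt_id τ).const_sub 1).const_mul (N * r)).neg).congr_deriv ?_
      simp
    refine (h1.exp.div_const N).congr_deriv ?_
    field_simp
  rw [intervalIntegral.integral_eq_sub_of_hasDerivAt h
    (Continuous.intervalIntegrable (by fun_prop) _ _)]
  simp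
  ring

/-- The integral `∫₀^s t u(t) dt`. -/
def firstMoment (u : ℝ → ℝ) (s : ℝ) : ℝ := ∫ t in (0 : ℝ)..s, t * u t

lemma hasDerivAt_firstMoment {u : ℝ → ℝ} (hu : Continuous u) (s : ℝ) :
    HasDerivAt (firstMoment u) (s * u s) s :=
  (continuous_id.mul hu).integral_hasStrictDerivAt 0 s |>.hasDerivAt

lemma continuous_firstMoment {u : ℝ → ℝ} (hu : Continuous u) : Continuous (firstMoment u) :=
  continuous_iff_continuousAt.2 fun s => (hasDerivAt_firstMoment hu s).continuousAt

/-- Integrating the weight `exp (N t)` gains a factor `1/N`, so the nonlocal dependence on `∫ t u`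
becomes small for large `N`. -/
lemma abs_firstMoment_sub_le {T N D s : ℝ} (hN : 0 < N) (hs : s ∈ Icc 0 T)
    {u u' : ℝ → ℝ} (hu : Continuous u) (hu' : Continuous u') (hD : 0 ≤ D)
    (h : ∀ t, |u t - u' t| ≤ Real.exp (N * t) * D) :
    |firstMoment u s - firstMoment u' s| ≤ T / N * Real.exp (N * s) * D := by
  unfold firstMoment
  rw [← intervalIntegral.integral_sub (Continuous.intervalIntegrable (by fun_prop) _ _)
    (Continuous.intervalIntegrable (by fun_prop) _ _)]
  have h1 : ‖∫ t in (0 : ℝ)..s, (t * u t - t * u' t)‖ ≤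
      ∫ t in (0 : ℝ)..s, T * D * Real.exp (N * t) := by
    refine intervalIntegral.norm_integral_le_of_norm_le hs.1 ?_
      (Continuous.intervalIntegrable (by fun_prop) _ _)
    refine Eventually.of_forall fun t ht => ?_
    rw [← mul_sub, Real.norm_eq_abs, abs_mul, abs_of_pos ht.1]
    calc t * |u t - u' t| ≤ T * (Real.exp (N * t) * D) :=
          mul_le_mul (ht.2.trans hs.2) (h t) (abs_nonneg _) (hs.1.trans hs.2)
      _ = _ := by ring
  have h2 : ∫ t in (0 : ℝ)..s, T * D * Real.exp (N * t) =
      T * D * ((Real.exp (N * s) - 1) / N) := by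
    have h : ∀ t ∈ uIcc (0 : ℝ) s, HasDerivAt (fun t => Real.exp (N * t) / N)
        (Real.exp (N * t)) t := by
      intro t _
      refine ((((hasDerivAt_id t).const_mul N).exp).div_const N).congr_deriv ?_
      simp; field_simp
    rw [intervalIntegral.integral_const_mul, intervalIntegral.integral_eq_sub_of_hasDerivAt h
      (Continuous.intervalIntegrable (by fun_prop) _ _), mul_zero, Real.exp_zero]
    ring
  rw [Real.norm_eq_abs, h2] at h1
  refine h1.trans ?_
  have hT : 0 ≤ T := hs.1.trans hs.2
  have : (Real.exp (N * s) - 1) / N ≤ Real.exp (N * s) / N := by gcongr; linarith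
  calc T * D * ((Real.exp (N * s) - 1) / N) ≤ T * D * (Real.exp (N * s) / N) := by gcongr
    _ = _ := by ring

/-- The source term along the profile `u`. -/
def sourceAlong (f : ℝ → ℝ → ℝ → ℝ) (u : ℝ → ℝ) (s : ℝ) : ℝ := f s (firstMoment u s) (u s)

lemma continuous_sourceAlong {f : ℝ → ℝ → ℝ → ℝ}
    (hf : Continuous fun p : ℝ × ℝ × ℝ => f p.1 p.2.1 p.2.2) {u : ℝ → ℝ} (hu : Continuous u) :
    Continuous (sourceAlong f u) :=
  hf.comp (continuous_id.prodMk ((continuous_firstMoment hu).prodMk hu))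

/-- The fixed-point operator of the singular initial value problem, in weighted form. -/
def singularOp {T : ℝ} (hT : 0 ≤ T) (N : ℝ) (f : ℝ → ℝ → ℝ → ℝ)
    (hf : Continuous fun p : ℝ × ℝ × ℝ => f p.1 p.2.1 p.2.2) (w : C(Icc (0 : ℝ) T, ℝ)) :
    C(Icc (0 : ℝ) T, ℝ) where
  toFun r := -(Real.exp (-(N * r)) *
    ∫ τ in (0 : ℝ)..1, τ ^ 4 * sourceAlong f (weightedExtend hT N w) (r * τ))
  continuous_toFun := by
    have h := continuous_sourceAlong hf (continuous_weightedExtend hT N w)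
    refine Continuous.neg (Continuous.mul (by fun_prop) ?_)
    refine intervalIntegral.continuous_parametric_intervalIntegral_of_continuous' ?_ 0 1
    simp only [Function.uncurry_def]
    exact (by fun_prop : Continuous fun p : Icc (0 : ℝ) T × ℝ => p.2 ^ 4).mul
      (h.comp (by fun_prop))

/-- The constant part `k` is damped only by `∫₀¹ τ⁴ = 1/5`, whatever the weight. The part `L r`
vanishes at the center and gains `1/N` from the weight, and so does the first moment. The
contraction thus needs only `k < 5`. -/
lemma dist_singularOp_le {T N L k : ℝ} (hT : 0 ≤ T) (hN : 0 < N) (hL : 0 ≤ L) (hk : 0 ≤ k)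
    {f : ℝ → ℝ → ℝ → ℝ} (hf : Continuous fun p : ℝ × ℝ × ℝ => f p.1 p.2.1 p.2.2)
    (hlip : ∀ r ∈ Icc 0 T, ∀ x x' v v' : ℝ,
      |f r x v - f r x' v'| ≤ L * |x - x'| + (k + L * r) * |v - v'|)
    (w w' : C(Icc (0 : ℝ) T, ℝ)) :
    dist (singularOp hT N f hf w) (singularOp hT N f hf w') ≤
      ((k + L * (T / N)) / 5 + L / N) * dist w w' := by
  have hC : 0 ≤ ((k + L * (T / N)) / 5 + L / N) * dist w w' := by positivity
  refine (ContinuousMap.dist_le hC).2 fun ⟨r, hr⟩ => ?_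
  set u := weightedExtend hT N w
  set u' := weightedExtend hT N w'
  have hu : Continuous u := continuous_weightedExtend hT N w
  have hu' : Continuous u' := continuous_weightedExtend hT N w'
  have hd (t) : |u t - u' t| ≤ Real.exp (N * t) * dist w w' :=
    abs_weightedExtend_sub_le hT N w w' t
  have hc := continuous_sourceAlong hf hu
  have hc' := continuous_sourceAlong hf hu'
  have hsrc (s : ℝ) (hs : s ∈ Icc 0 T) : |sourceAlong f u s - sourceAlong f u' s| ≤
      (k + L * (T / N) + L * s) * Real.exp (N * s) * dist w w' := by
    refine (hlip s hs _ _ _ _).trans ?_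
    have h1 := abs_firstMoment_sub_le hN hs hu hu' dist_nonneg hd
    have h2 : 0 ≤ k + L * s := add_nonneg hk (mul_nonneg hL hs.1)
    calc _ ≤ L * (T / N * Real.exp (N * s) * dist w w')
          + (k + L * s) * (Real.exp (N * s) * dist w w') :=
        add_le_add (mul_le_mul_of_nonneg_left h1 hL) (mul_le_mul_of_nonneg_left (hd s) h2)
      _ = _ := by ring
  rw [Real.dist_eq]
  change |-(Real.exp (-(N * r)) * ∫ τ in (0 : ℝ)..1, τ ^ 4 * sourceAlong f u (r * τ)) -
    -(Real.exp (-(N * r)) * ∫ τ in (0 : ℝ)..1, τ ^ 4 * sourceAlong f u' (r * τ))| ≤ _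
  have e1 : -(Real.exp (-(N * r)) * ∫ τ in (0 : ℝ)..1, τ ^ 4 * sourceAlong f u (r * τ)) -
      -(Real.exp (-(N * r)) * ∫ τ in (0 : ℝ)..1, τ ^ 4 * sourceAlong f u' (r * τ)) =
      ∫ τ in (0 : ℝ)..1, Real.exp (-(N * r)) *
        (τ ^ 4 * sourceAlong f u' (r * τ) - τ ^ 4 * sourceAlong f u (r * τ)) := by
    rw [intervalIntegral.integral_const_mul, intervalIntegral.integral_sub
      (Continuous.intervalIntegrable (by fun_prop) _ _)
      (Continuous.intervalIntegrable (by fun_prop) _ _)]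
    ring
  rw [e1, ← Real.norm_eq_abs]
  -- In the first summand the exponential is bounded by 1 and `τ⁴` is kept; in the second `τ⁵` is
  -- bounded by 1 and the exponential is kept, since its integral gives `1/N`.
  have h1 : ‖∫ τ in (0 : ℝ)..1, Real.exp (-(N * r)) *
        (τ ^ 4 * sourceAlong f u' (r * τ) - τ ^ 4 * sourceAlong f u (r * τ))‖ ≤
      ∫ τ in (0 : ℝ)..1, ((k + L * (T / N)) * dist w w' * τ ^ 4
        + L * dist w w' * (r * Real.exp (-(N * r * (1 - τ))))) := by
    refine intervalIntegral.norm_integral_le_of_norm_le zero_le_one ?_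
      (Continuous.intervalIntegrable (by fun_prop) _ _)
    refine Eventually.of_forall fun τ hτ => ?_
    have hτ0 : 0 ≤ τ := hτ.1.le
    have hτ4 : τ ^ 4 ≤ 1 := pow_le_one₀ hτ0 hτ.2
    have hτ5 : τ ^ 4 * τ ≤ 1 := mul_le_one₀ hτ4 hτ0 hτ.2
    have hrτ : r * τ ∈ Icc 0 T :=
      ⟨mul_nonneg hr.1 hτ0, (mul_le_of_le_one_right hr.1 hτ.2).trans hr.2⟩
    have hE : Real.exp (-(N * r)) * Real.exp (N * (r * τ)) = Real.exp (-(N * r * (1 - τ))) := by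
      rw [← Real.exp_add]; congr 1; ring
    have hE1 : Real.exp (-(N * r * (1 - τ))) ≤ 1 := by
      rw [Real.exp_le_one_iff]
      have : 0 ≤ N * r * (1 - τ) := mul_nonneg (mul_nonneg hN.le hr.1) (by linarith [hτ.2])
      linarith
    rw [← mul_sub, Real.norm_eq_abs, abs_mul, abs_mul, abs_of_pos (Real.exp_pos _),
      abs_of_nonneg (pow_nonneg hτ0 4), abs_sub_comm]
    calc Real.exp (-(N * r)) * (τ ^ 4 * |sourceAlong f u (r * τ) - sourceAlong f u' (r * τ)|)
        ≤ Real.exp (-(N * r)) * (τ ^ 4 *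
          ((k + L * (T / N) + L * (r * τ)) * Real.exp (N * (r * τ)) * dist w w')) := by
          gcongr; exact hsrc _ hrτ
      _ = (k + L * (T / N)) * dist w w' * τ ^ 4 * (Real.exp (-(N * r)) * Real.exp (N * (r * τ)))
          + L * dist w w' * (r * (Real.exp (-(N * r)) * Real.exp (N * (r * τ)))) * (τ ^ 4 * τ) := by
          ring
      _ ≤ _ := by
          rw [hE]
          have hr0 := hr.1
          refine add_le_add (mul_le_of_le_one_right (by positivity) hE1)
            (mul_le_of_le_one_right (by positivity) hτ5)
  refine h1.trans ?_
  rw [intervalIntegral.integral_add (Continuous.intervalIntegrable (by fun_prop) _ _)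
    (Continuous.intervalIntegrable (by fun_prop) _ _), intervalIntegral.integral_const_mul,
    intervalIntegral.integral_const_mul, integral_mul_exp_neg hN, integral_pow]
  have : (1 - Real.exp (-(N * r))) / N ≤ 1 / N := by
    gcongr; linarith [Real.exp_pos (-(N * r))]
  have h2 := mul_le_mul_of_nonneg_left this (by positivity : 0 ≤ L * dist w w')
  calc _ ≤ (k + L * (T / N)) * dist w w' * ((1 ^ (4 + 1) - 0 ^ (4 + 1)) / ((4 : ℕ) + 1))
        + L * dist w w' * (1 / N) := by gcongr
    _ = _ := by push_cast; ring

/-- Existence for the singular problem `r v' = -5 v - f(r, ∫₀^r s v ds, v)` on `[0, T]`, with `v`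
continuous up to `r = 0`. -/
theorem exists_singular_ivp {T L k : ℝ} (hT : 0 ≤ T) (hL : 0 ≤ L) (hk : 0 ≤ k) (hk5 : k < 5)
    {f : ℝ → ℝ → ℝ → ℝ} (hf : Continuous fun p : ℝ × ℝ × ℝ => f p.1 p.2.1 p.2.2)
    (hlip : ∀ r ∈ Icc 0 T, ∀ x x' v v' : ℝ,
      |f r x v - f r x' v'| ≤ L * |x - x'| + (k + L * r) * |v - v'|) :
    ∃ v : ℝ → ℝ, Continuous v ∧ ∀ r ∈ Ioc 0 T,
      r ^ 5 * v r = -∫ s in (0 : ℝ)..r, s ^ 4 * sourceAlong f v s := by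
  obtain ⟨N, hN, hq⟩ : ∃ N : ℝ, 0 < N ∧ (k + L * (T / N)) / 5 + L / N < 1 := by
    have h5 : 0 < 5 - k := by linarith
    -- The factor is `k/5 + (L T + 5 L)/(5 N)`, which is below 1 once `N > (L T + 5 L)/(5 - k)`; the
    -- added 1 makes this strict.
    refine ⟨(L * T + 5 * L + 1) / (5 - k), by positivity, ?_⟩
    have hp : 0 < L * T + 5 * L + 1 := by positivity
    have : (k + L * (T / ((L * T + 5 * L + 1) / (5 - k)))) / 5 + L / ((L * T + 5 * L + 1) / (5 - k))
        = 1 - (5 - k) / (5 * (L * T + 5 * L + 1)) := by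
      field_simp
      ring
    rw [this]
    have : 0 < (5 - k) / (5 * (L * T + 5 * L + 1)) := by positivity
    linarith
  set q : ℝ := (k + L * (T / N)) / 5 + L / N
  have hq0 : 0 ≤ q := by positivity
  have hcontr : ContractingWith ⟨q, hq0⟩ (singularOp hT N f hf) :=
    ⟨by exact_mod_cast hq, LipschitzWith.of_dist_le_mul fun w w' =>
      dist_singularOp_le hT hN hL hk hf hlip w w'⟩
  set w := ContractingWith.fixedPoint (singularOp hT N f hf) hcontr
  have hw : singularOp hT N f hf w = w := hcontr.fixedPoint_isFixedPt
  refine ⟨weightedExtend hT N w, continuous_weightedExtend hT N w, fun r hr => ?_⟩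
  have hr' : r ∈ Icc 0 T := Ioc_subset_Icc_self hr
  have h1 : weightedExtend hT N w r =
      -∫ τ in (0 : ℝ)..1, τ ^ 4 * sourceAlong f (weightedExtend hT N w) (r * τ) := by
    conv_lhs => rw [weightedExtend, projIcc_of_mem hT hr', ← hw]
    change Real.exp (N * r) * -(Real.exp (-(N * r)) * _) = _
    rw [mul_neg, ← mul_assoc, ← Real.exp_add]
    simp
  rw [h1, mul_neg]
  congr 1
  have h2 := intervalIntegral.mul_integral_comp_mul_left (a := 0) (b := 1)
    (f := fun s => s ^ 4 * sourceAlong f (weightedExtend hT N w) s) r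
  simp only [mul_zero, mul_one] at h2
  rw [← h2, ← intervalIntegral.integral_const_mul, ← intervalIntegral.integral_const_mul]
  congr 1
  ext τ
  ring

end SingularIVP

/-! ### Structure equations with globally bounded Lipschitz coefficients. -/

section Profile

/-- Truncation to `[a, b]`. -/
def clamp (a b x : ℝ) : ℝ := max a (min b x)

lemma clamp_mem {a b : ℝ} (hab : a ≤ b) (x : ℝ) : clamp a b x ∈ Icc a b :=
  ⟨le_max_left _ _, max_le hab (min_le_left _ _)⟩

lemma clamp_of_mem {a b x : ℝ} (hx : x ∈ Icc a b) : clamp a b x = x := by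
  rw [clamp, min_eq_right hx.2, max_eq_right hx.1]

lemma abs_clamp_sub_le (a b x y : ℝ) : |clamp a b x - clamp a b y| ≤ |x - y| := by
  unfold clamp
  refine (abs_max_sub_max_le_max _ _ _ _).trans ?_
  refine max_le (by simp) ((abs_min_sub_min_le_max _ _ _ _).trans ?_)
  simp

lemma continuous_clamp (a b : ℝ) : Continuous (clamp a b) :=
  continuous_const.max (continuous_const.min continuous_id)

/-- The mean compression `η` determined by `v = (δ - η) / r²`. -/
def meanOf (δc : ℝ) (v : ℝ → ℝ) (r : ℝ) : ℝ := δc + 3 * firstMoment v r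

/-- The compression `δ` determined by `v = (δ - η) / r²`. -/
def densityOf (δc : ℝ) (v : ℝ → ℝ) (r : ℝ) : ℝ := meanOf δc v r + r ^ 2 * v r

lemma hasDerivAt_meanOf {δc : ℝ} {v : ℝ → ℝ} (hv : Continuous v) (r : ℝ) :
    HasDerivAt (meanOf δc v) (3 * (r * v r)) r :=
  ((hasDerivAt_firstMoment hv r).const_mul 3).const_add δc

lemma continuous_meanOf {δc : ℝ} {v : ℝ → ℝ} (hv : Continuous v) : Continuous (meanOf δc v) :=
  continuous_iff_continuousAt.2 fun r => (hasDerivAt_meanOf hv r).continuousAt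

lemma continuous_densityOf {δc : ℝ} {v : ℝ → ℝ} (hv : Continuous v) :
    Continuous (densityOf δc v) :=
  (continuous_meanOf hv).add ((continuous_pow 2).mul hv)

@[simp] lemma meanOf_zero {δc : ℝ} {v : ℝ → ℝ} : meanOf δc v 0 = δc := by
  simp [meanOf, firstMoment]

@[simp] lemma densityOf_zero {δc : ℝ} {v : ℝ → ℝ} : densityOf δc v 0 = δc := by
  simp [densityOf]

/-- Global solution of the structure equations with bounded Lipschitz coefficients. -/
theorem exists_profile {δc T L Fm FM : ℝ} (hT : 0 < T) (hL : 0 ≤ L) (hFm : 0 < Fm)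
    {B F : ℝ → ℝ → ℝ} (hBc : Continuous fun p : ℝ × ℝ => B p.1 p.2)
    (hFc : Continuous fun p : ℝ × ℝ => F p.1 p.2)
    (hB : ∀ d e, B d e ∈ Icc (-1 / 2) 0) (hF : ∀ d e, F d e ∈ Icc Fm FM)
    (hBL : ∀ d e d' e', |B d e - B d' e'| ≤ L * (|d - d'| + |e - e'|))
    (hFL : ∀ d e d' e', |F d e - F d' e'| ≤ L * (|d - d'| + |e - e'|)) :
    ∃ v : ℝ → ℝ, Continuous v ∧ (∀ r ∈ Ioc 0 T, v r < 0) ∧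
      (∀ r ∈ Ioo 0 T, HasDerivAt (densityOf δc v)
        (-(r * (B (densityOf δc v r) (meanOf δc v r) * v r
          + F (densityOf δc v r) (meanOf δc v r)))) r) := by
  have hFM : 0 < FM := hFm.trans_le ((hF 0 0).1.trans (hF 0 0).2)
  -- Truncating the factor `v` to `[-FM, 0]` makes `B · v` globally Lipschitz; the solution is shown
  -- below to lie in that interval. The values of `B` contribute `k = 1/2`, and the dependence of
  -- `δ` on `r² v` contributes the terms with factor `r`.
  set f : ℝ → ℝ → ℝ → ℝ := fun r x v =>
    B (δc + 3 * x + r ^ 2 * v) (δc + 3 * x) * clamp (-FM) 0 v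
      + F (δc + 3 * x + r ^ 2 * v) (δc + 3 * x) with hf
  have hcl (v : ℝ) := clamp_mem (by linarith : -FM ≤ 0) v
  have hfc : Continuous fun p : ℝ × ℝ × ℝ => f p.1 p.2.1 p.2.2 := by
    have hq : Continuous fun p : ℝ × ℝ × ℝ =>
        (δc + 3 * p.2.1 + p.1 ^ 2 * p.2.2, δc + 3 * p.2.1) := by fun_prop
    exact ((hBc.comp hq).mul ((continuous_clamp (-FM) 0).comp (by fun_prop))).add (hFc.comp hq)
  have hlip : ∀ r ∈ Icc 0 T, ∀ x x' v v' : ℝ, |f r x v - f r x' v'| ≤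
      ((FM + 1) * L * (T + 6)) * |x - x'| + (1 / 2 + ((FM + 1) * L * (T + 6)) * r) * |v - v'| := by
    intro r hr x x' v v'
    simp only [hf]
    set d := δc + 3 * x + r ^ 2 * v
    set d' := δc + 3 * x' + r ^ 2 * v'
    set e := δc + 3 * x
    set e' := δc + 3 * x'
    have hde : |d - d'| + |e - e'| ≤ 6 * |x - x'| + r * T * |v - v'| := by
      have h1 : |e - e'| = 3 * |x - x'| := by
        rw [show e - e' = 3 * (x - x') by simp only [e, e']; ring, abs_mul]; norm_num
      have h2 : |d - d'| ≤ 3 * |x - x'| + r * r * |v - v'| := by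
        rw [show d - d' = 3 * (x - x') + r * r * (v - v') by simp only [d, d']; ring]
        refine (abs_add_le _ _).trans ?_
        rw [abs_mul, abs_mul, abs_of_nonneg (mul_nonneg hr.1 hr.1)]
        norm_num
      have h3 : r * r * |v - v'| ≤ r * T * |v - v'| := by
        have := hr.1
        gcongr
        exact hr.2
      linarith
    have hv1 : |clamp (-FM) 0 v'| ≤ FM := by
      rw [abs_le]; exact ⟨(hcl v').1, (hcl v').2.trans hFM.le⟩
    have hB1 : |B d e| ≤ 1 / 2 := by
      rw [abs_le]; exact ⟨by linarith [(hB d e).1], by linarith [(hB d e).2]⟩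
    have split : B d e * clamp (-FM) 0 v + F d e - (B d' e' * clamp (-FM) 0 v' + F d' e') =
        B d e * (clamp (-FM) 0 v - clamp (-FM) 0 v') + (B d e - B d' e') * clamp (-FM) 0 v'
          + (F d e - F d' e') := by ring
    rw [split]
    refine (abs_add_three _ _ _).trans ?_
    rw [abs_mul, abs_mul]
    have t1 : |B d e| * |clamp (-FM) 0 v - clamp (-FM) 0 v'| ≤ 1 / 2 * |v - v'| :=
      mul_le_mul hB1 (abs_clamp_sub_le _ _ _ _) (abs_nonneg _) (by norm_num)
    have t2 : |B d e - B d' e'| * |clamp (-FM) 0 v'| ≤ L * (|d - d'| + |e - e'|) * FM :=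
      mul_le_mul (hBL _ _ _ _) hv1 (abs_nonneg _) (by positivity)
    have t3 := hFL d e d' e'
    have t4 : (FM + 1) * L * (|d - d'| + |e - e'|) ≤
        (FM + 1) * L * (6 * |x - x'| + r * T * |v - v'|) :=
      mul_le_mul_of_nonneg_left hde (by positivity)
    have t5 : (FM + 1) * L * (6 * |x - x'| + r * T * |v - v'|) ≤
        (FM + 1) * L * (T + 6) * (|x - x'| + r * |v - v'|) := by
      rw [mul_assoc _ (T + 6)]
      refine mul_le_mul_of_nonneg_left ?_ (by positivity)
      have a1 : 0 ≤ T * |x - x'| := by positivity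
      have a2 : 0 ≤ r * |v - v'| := mul_nonneg hr.1 (abs_nonneg _)
      nlinarith
    nlinarith
  obtain ⟨v, hv, hint⟩ := exists_singular_ivp hT.le (by positivity) (by norm_num) (by norm_num)
    hfc hlip
  set Φ := sourceAlong f v with hΦ
  have hΦc : Continuous Φ := continuous_sourceAlong hfc hv
  have hΦ1 (s) : Fm ≤ Φ s := by
    have h1 := mul_nonneg_of_nonpos_of_nonpos
      (hB (δc + 3 * firstMoment v s + s ^ 2 * v s) (δc + 3 * firstMoment v s)).2 (hcl (v s)).2
    have h2 := (hF (δc + 3 * firstMoment v s + s ^ 2 * v s) (δc + 3 * firstMoment v s)).1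
    simp only [hΦ, sourceAlong, hf]
    linarith
  -- The true bound is `3/2 FM`; the factor 5 cancels the `1/5` from `∫ s⁴` and is enough for `v ≥
  -- -FM`.
  have hΦ2 (s) : Φ s ≤ 5 * FM := by
    have hb := hB (δc + 3 * firstMoment v s + s ^ 2 * v s) (δc + 3 * firstMoment v s)
    have h2 := (hF (δc + 3 * firstMoment v s + s ^ 2 * v s) (δc + 3 * firstMoment v s)).2
    have h3 := hcl (v s)
    simp only [hΦ, sourceAlong, hf]
    nlinarith [hb.1, hb.2, h3.1, h3.2]
  have hint4 (r : ℝ) (C : ℝ) : ∫ s in (0 : ℝ)..r, s ^ 4 * C = r ^ 5 * (C / 5) := by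
    rw [intervalIntegral.integral_mul_const, integral_pow]; push_cast; ring
  have hI1 (r) (hr : 0 < r) : r ^ 5 * (Fm / 5) ≤ ∫ s in (0 : ℝ)..r, s ^ 4 * Φ s := by
    rw [← hint4]
    refine intervalIntegral.integral_mono_on hr.le (Continuous.intervalIntegrable (by fun_prop) _ _)
      (Continuous.intervalIntegrable (by fun_prop) _ _) fun s hs => ?_
    exact mul_le_mul_of_nonneg_left (hΦ1 s) (pow_nonneg hs.1 4)
  have hI2 (r) (hr : 0 < r) : ∫ s in (0 : ℝ)..r, s ^ 4 * Φ s ≤ r ^ 5 * FM := by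
    rw [show FM = 5 * FM / 5 by ring, ← hint4]
    refine intervalIntegral.integral_mono_on hr.le (Continuous.intervalIntegrable (by fun_prop) _ _)
      (Continuous.intervalIntegrable (by fun_prop) _ _) fun s hs => ?_
    exact mul_le_mul_of_nonneg_left (hΦ2 s) (pow_nonneg hs.1 4)
  have hneg : ∀ r ∈ Ioc 0 T, v r < 0 := by
    intro r hr
    have h5 : 0 < r ^ 5 := pow_pos hr.1 5
    have : 0 < r ^ 5 * (Fm / 5) := by positivity
    nlinarith [hint r hr, hI1 r hr.1]
  have hlow : ∀ r ∈ Ioc 0 T, -FM ≤ v r := by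
    intro r hr
    have h5 : 0 < r ^ 5 := pow_pos hr.1 5
    have h6 : r ^ 5 * -FM ≤ r ^ 5 * v r := by linarith [hint r hr, hI2 r hr.1]
    exact le_of_mul_le_mul_left h6 h5
  refine ⟨v, hv, hneg, fun r hr => ?_⟩
  have hr0 : r ≠ 0 := hr.1.ne'
  have hrT : r ∈ Ioc 0 T := Ioo_subset_Ioc_self hr
  have hΦr : Φ r = B (densityOf δc v r) (meanOf δc v r) * v r
      + F (densityOf δc v r) (meanOf δc v r) := by
    simp only [hΦ, sourceAlong, hf]
    rw [clamp_of_mem ⟨hlow r hrT, (hneg r hrT).le⟩]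
    rfl
  have hJ : HasDerivAt (fun r => ∫ s in (0 : ℝ)..r, s ^ 4 * Φ s) (r ^ 4 * Φ r) r :=
    (((continuous_pow 4).mul hΦc).integral_hasStrictDerivAt 0 r).hasDerivAt
  -- As `v` is only known to be continuous, `r² v` is differentiated through the integral equation,
  -- as `-(∫₀^r s⁴ Φ)/r³`.
  have hz : HasDerivAt (fun r => meanOf δc v r + -(∫ s in (0 : ℝ)..r, s ^ 4 * Φ s) / r ^ 3)
      (3 * (r * v r) + ((-(r ^ 4 * Φ r)) * r ^ 3
        - -(∫ s in (0 : ℝ)..r, s ^ 4 * Φ s) * ((3 : ℕ) * r ^ (3 - 1))) / (r ^ 3) ^ 2) r :=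
    (hasDerivAt_meanOf hv r).add (hJ.neg.div (hasDerivAt_pow 3 r) (pow_ne_zero 3 hr0))
  refine (hz.congr_of_eventuallyEq ?_).congr_deriv ?_
  · filter_upwards [Ioo_mem_nhds hr.1 hr.2] with s hs
    rw [← hint s (Ioo_subset_Ioc_self hs), densityOf]
    have := hs.1.ne'
    field_simp
  · rw [← hint r hrT, ← hΦr]
    field_simp
    norm_num
    ring

end Profile

/-! ### Bounds and truncation of the shear and gravity coefficients. -/

section Coefficients

/-- A `C¹` function composed with truncation to a box is Lipschitz. -/
lemma exists_lipschitz_clamp {a b a' b' : ℝ} (hab : a ≤ b) (hab' : a' ≤ b') {f : ℝ → ℝ → ℝ}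
    (hf : ∀ x ∈ Icc a b, ∀ y ∈ Icc a' b', ContDiffAt ℝ 1 (fun q : ℝ × ℝ => f q.1 q.2) (x, y)) :
    ∃ L : ℝ, 0 ≤ L ∧ ∀ d e d' e', |f (clamp a b d) (clamp a' b' e)
      - f (clamp a b d') (clamp a' b' e')| ≤ L * (|d - d'| + |e - e'|) := by
  have hloc : LocallyLipschitzOn (Icc a b ×ˢ Icc a' b') (fun q : ℝ × ℝ => f q.1 q.2) := by
    rintro ⟨x, y⟩ ⟨hx, hy⟩
    obtain ⟨K, t, ht, hK⟩ := (hf x hx y hy).exists_lipschitzOnWith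
    exact ⟨K, t, mem_nhdsWithin_of_mem_nhds ht, hK⟩
  obtain ⟨K, hK⟩ := hloc.exists_lipschitzOnWith_of_compact (isCompact_Icc.prod isCompact_Icc)
  refine ⟨K, K.2, fun d e d' e' => ?_⟩
  have := hK.dist_le_mul (clamp a b d, clamp a' b' e) ⟨clamp_mem hab d, clamp_mem hab' e⟩
    (clamp a b d', clamp a' b' e') ⟨clamp_mem hab d', clamp_mem hab' e'⟩
  rw [Real.dist_eq, Prod.dist_eq, Real.dist_eq, Real.dist_eq] at this
  refine this.trans (mul_le_mul_of_nonneg_left (max_le ?_ ?_) K.2)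
  · exact (abs_clamp_sub_le _ _ _ _).trans (by linarith [abs_nonneg (e - e')])
  · exact (abs_clamp_sub_le _ _ _ _).trans (by linarith [abs_nonneg (d - d')])

lemma continuous_of_lipschitz_bound {f : ℝ → ℝ → ℝ} {L : ℝ}
    (hf : ∀ d e d' e', |f d e - f d' e'| ≤ L * (|d - d'| + |e - e'|)) :
    Continuous fun p : ℝ × ℝ => f p.1 p.2 := by
  rw [continuous_iff_continuousAt]
  intro p
  have h : Tendsto (fun q : ℝ × ℝ => L * (|q.1 - p.1| + |q.2 - p.2|)) (𝓝 p) (𝓝 0) := by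
    have : Continuous fun q : ℝ × ℝ => L * (|q.1 - p.1| + |q.2 - p.2|) := by fun_prop
    simpa using this.tendsto p
  rw [ContinuousAt, tendsto_iff_dist_tendsto_zero]
  exact squeeze_zero (fun _ => dist_nonneg) (fun q => hf _ _ _ _) h

variable {lam mu κ δc : ℝ}

lemma contDiffAt_shearCoeff {d e : ℝ} (he : 0 < e) (hh : radProfile lam mu e ≠ 0) :
    ContDiffAt ℝ 1 (fun q : ℝ × ℝ => shearCoeff lam mu q.1 q.2) (d, e) := by
  unfold shearCoeff
  have hg : ContDiffAt ℝ 1 (fun q : ℝ × ℝ => shearProfile lam mu q.2) (d, e) :=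
    (contDiffAt_shearProfile he).comp (d, e) contDiffAt_snd
  have hr : ContDiffAt ℝ 1 (fun q : ℝ × ℝ => radProfile lam mu q.2) (d, e) :=
    (contDiffAt_radProfile he).comp (d, e) contDiffAt_snd
  exact (((contDiffAt_const.mul hg).mul contDiffAt_fst).mul
    (contDiffAt_fst.sub contDiffAt_snd)).div (hr.mul (contDiffAt_snd.pow 2))
    (mul_ne_zero hh (pow_pos he 2).ne')

lemma contDiffAt_gravityCoeff {d e : ℝ} (he : 0 < e) (hh : radProfile lam mu e ≠ 0) :
    ContDiffAt ℝ 1 (fun q : ℝ × ℝ => gravityCoeff lam mu κ q.1 q.2) (d, e) := by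
  unfold gravityCoeff
  have hr : ContDiffAt ℝ 1 (fun q : ℝ × ℝ => radProfile lam mu q.2) (d, e) :=
    (contDiffAt_radProfile he).comp (d, e) contDiffAt_snd
  exact ((contDiffAt_const.mul (contDiffAt_fst.pow 3)).mul contDiffAt_snd).div hr hh

/-- The lower bound combines `g < h` with `4δ(η - δ) ≤ η²`. -/
lemma shearCoeff_mem {d e : ℝ} (hlam : 0 < lam) (hmu : 0 ≤ mu) (hd : 0 < d) (hde : d ≤ e)
    (he : e < criticalDensity lam mu) : shearCoeff lam mu d e ∈ Icc (-1 / 2) 0 := by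
  have he0 : 0 < e := hd.trans_le hde
  have hg := shearProfile_pos hlam hmu he0 he
  have hgh := shearProfile_lt_radProfile hlam hmu he0
  have hh := hg.trans hgh
  have hD : 0 < radProfile lam mu e * e ^ 2 := by positivity
  unfold shearCoeff
  constructor
  · rw [le_div_iff₀ hD]
    have h1 : 4 * d * (e - d) ≤ e ^ 2 := by nlinarith [sq_nonneg (e - 2 * d)]
    have h2 : shearProfile lam mu e * (4 * d * (e - d)) ≤ radProfile lam mu e * e ^ 2 :=
      mul_le_mul hgh.le h1 (by have := sub_nonneg.2 hde; positivity) hh.le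
    nlinarith
  · refine div_nonpos_of_nonpos_of_nonneg ?_ hD.le
    exact mul_nonpos_of_nonneg_of_nonpos (by positivity) (by linarith)

/-- Lower bound of the compression in the matter region. -/
def minDensity (lam mu : ℝ) : ℝ := (lam + mu) / (lam + 2 * mu)

lemma minDensity_pos (hlam : 0 < lam) (hmu : 0 ≤ mu) : 0 < minDensity lam mu := by
  unfold minDensity; positivity

lemma minDensity_le_one (hlam : 0 < lam) (hmu : 0 ≤ mu) : minDensity lam mu ≤ 1 := by
  unfold minDensity; rw [div_le_one (by positivity)]; linarith

/-- Truncated version of `shearCoeff`. -/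
def clampedShear (lam mu δc d e : ℝ) : ℝ :=
  clamp (-1 / 2) 0 (shearCoeff lam mu (clamp (minDensity lam mu) δc d) (clamp 1 δc e))

/-- Truncated version of `gravityCoeff`. -/
def clampedGravity (lam mu κ δc d e : ℝ) : ℝ :=
  gravityCoeff lam mu κ (clamp (minDensity lam mu) δc d) (clamp 1 δc e)

/-- The outer truncation is needed because the box of arguments also contains pairs with `δ > η`,
where the coefficient is positive. -/
lemma clampedShear_mem (d e : ℝ) : clampedShear lam mu δc d e ∈ Icc (-1 / 2) 0 :=
  clamp_mem (by norm_num) _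

lemma clampedShear_eq (hlam : 0 < lam) (hmu : 0 ≤ mu) (hc : δc < criticalDensity lam mu) {d e : ℝ}
    (hd : d ∈ Icc (minDensity lam mu) δc) (he : e ∈ Icc 1 δc) (hde : d ≤ e) :
    clampedShear lam mu δc d e = shearCoeff lam mu d e := by
  rw [clampedShear, clamp_of_mem hd, clamp_of_mem he, clamp_of_mem]
  exact shearCoeff_mem hlam hmu ((minDensity_pos hlam hmu).trans_le hd.1) hde (he.2.trans_lt hc)

lemma clampedGravity_eq {d e : ℝ} (hd : d ∈ Icc (minDensity lam mu) δc) (he : e ∈ Icc 1 δc) :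
    clampedGravity lam mu κ δc d e = gravityCoeff lam mu κ d e := by
  rw [clampedGravity, clamp_of_mem hd, clamp_of_mem he]

lemma exists_clamped_bounds (hlam : 0 < lam) (hmu : 0 ≤ mu) (hκ : 0 < κ) (h1 : 1 < δc)
    (hc : δc < criticalDensity lam mu) :
    ∃ L Fm FM : ℝ, 0 ≤ L ∧ 0 < Fm ∧ (∀ d e, clampedGravity lam mu κ δc d e ∈ Icc Fm FM) ∧
      (∀ d e d' e', |clampedShear lam mu δc d e - clampedShear lam mu δc d' e'| ≤
        L * (|d - d'| + |e - e'|)) ∧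
      (∀ d e d' e', |clampedGravity lam mu κ δc d e - clampedGravity lam mu κ δc d' e'| ≤
        L * (|d - d'| + |e - e'|)) := by
  have hd0 := minDensity_pos hlam hmu
  have hd1 : minDensity lam mu ≤ δc := (minDensity_le_one hlam hmu).trans h1.le
  have hh (e) (he : e ∈ Icc 1 δc) : 0 < radProfile lam mu e :=
    radProfile_pos hlam hmu (by linarith [he.1]) (he.2.trans_lt hc)
  obtain ⟨L1, hL1, hB⟩ := exists_lipschitz_clamp hd1 h1.le (f := shearCoeff lam mu)
    fun x _ y hy => contDiffAt_shearCoeff (by linarith [hy.1]) (hh y hy).ne'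
  obtain ⟨L2, hL2, hF⟩ := exists_lipschitz_clamp hd1 h1.le (f := gravityCoeff lam mu κ)
    fun x _ y hy => contDiffAt_gravityCoeff (by linarith [hy.1]) (hh y hy).ne'
  have hcont : ContinuousOn (fun q : ℝ × ℝ => gravityCoeff lam mu κ q.1 q.2)
      (Icc (minDensity lam mu) δc ×ˢ Icc 1 δc) := fun q hq =>
    (contDiffAt_gravityCoeff (by linarith [hq.2.1]) (hh q.2 hq.2).ne').continuousAt
      |>.continuousWithinAt
  have hcomp : IsCompact (Icc (minDensity lam mu) δc ×ˢ Icc 1 δc) :=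
    isCompact_Icc.prod isCompact_Icc
  have hne : (Icc (minDensity lam mu) δc ×ˢ Icc 1 δc).Nonempty :=
    ⟨(δc, δc), ⟨hd1, le_rfl⟩, ⟨h1.le, le_rfl⟩⟩
  obtain ⟨p, hp, hpmin⟩ := hcomp.exists_isMinOn hne hcont
  obtain ⟨q, hq, hqmax⟩ := hcomp.exists_isMaxOn hne hcont
  refine ⟨L1 + L2, gravityCoeff lam mu κ p.1 p.2, gravityCoeff lam mu κ q.1 q.2, by positivity,
    ?_, fun d e => ?_, fun d e d' e' => ?_, fun d e d' e' => ?_⟩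
  · have a1 := hd0.trans_le hp.1.1
    have a2 : 0 < p.2 := by linarith [hp.2.1]
    have a3 := hh p.2 hp.2
    unfold gravityCoeff
    positivity
  · have hm : ((clamp (minDensity lam mu) δc d, clamp 1 δc e) : ℝ × ℝ) ∈
        Icc (minDensity lam mu) δc ×ˢ Icc 1 δc := ⟨clamp_mem hd1 d, clamp_mem h1.le e⟩
    exact ⟨hpmin hm, hqmax hm⟩
  · refine (abs_clamp_sub_le _ _ _ _).trans ((hB d e d' e').trans ?_)
    gcongr; linarith
  · refine (hF d e d' e').trans ?_
    gcongr; linarith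

end Coefficients

/-! ### Uniqueness for the structure equations. -/

section Flow

/-- Solutions `(δ, η)` of the structure equations on `(0, R)` which start from the center and stay
in the admissible region. -/
structure IsStructureFlow (lam mu κ δc R : ℝ) (δ η : ℝ → ℝ) : Prop where
  hasDerivAt_mean : ∀ r ∈ Ioo 0 R, HasDerivAt η (3 * (δ r - η r) / r) r
  hasDerivAt_density : ∀ r ∈ Ioo 0 R, HasDerivAt δ
    (-(shearCoeff lam mu (δ r) (η r) * (δ r - η r) / r)
      - r * gravityCoeff lam mu κ (δ r) (η r)) r
  density_mem : ∀ r ∈ Ioo 0 R, δ r ∈ Icc (minDensity lam mu) δc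
  mean_mem : ∀ r ∈ Ioo 0 R, η r ∈ Icc 1 δc
  density_le_mean : ∀ r ∈ Ioo 0 R, δ r ≤ η r
  tendsto_density : Tendsto δ (𝓝[>] 0) (𝓝 δc)
  tendsto_mean : Tendsto η (𝓝[>] 0) (𝓝 δc)

/-- Only the limit at the singular endpoint enters; the value of `Q` at 0 is irrelevant. -/
lemma nonpos_of_deriv_nonpos_of_tendsto {R : ℝ} {Q Q' : ℝ → ℝ}
    (hQ : ∀ r ∈ Ioo 0 R, HasDerivAt Q (Q' r) r) (hneg : ∀ r ∈ Ioo 0 R, Q' r ≤ 0)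
    (h0 : Tendsto Q (𝓝[>] 0) (𝓝 0)) : ∀ r ∈ Ioo 0 R, Q r ≤ 0 := by
  have hanti : AntitoneOn Q (Ioo 0 R) := by
    refine antitoneOn_of_deriv_nonpos (convex_Ioo 0 R)
      (fun r hr => (hQ r hr).continuousAt.continuousWithinAt) ?_ ?_
    · rw [interior_Ioo]
      exact fun r hr => (hQ r hr).differentiableAt.differentiableWithinAt
    · rw [interior_Ioo]
      intro r hr
      rw [(hQ r hr).deriv]
      exact hneg r hr
  intro r hr
  refine ge_of_tendsto h0 ?_
  filter_upwards [Ioo_mem_nhdsGT hr.1] with s hs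
  exact hanti ⟨hs.1, hs.2.trans hr.2⟩ hr hs.2.le

variable {lam mu κ δc R : ℝ}

/-- With `y = η - δ` one has `(r² y)' = -r y (1 + b) + r³ F ≤ FM r³`, because `b ≥ -1/2`;
integration from the center gives the constant `FM/4`. The bound makes `(δ - η)/r` vanish at the
center and controls the coefficient of `b₁ - b₂` in the uniqueness estimate. -/
lemma IsStructureFlow.exists_deficit_le {δ η : ℝ → ℝ} (h : IsStructureFlow lam mu κ δc R δ η)
    (hlam : 0 < lam) (hmu : 0 ≤ mu) (hκ : 0 < κ) (h1 : 1 < δc) (hc : δc < criticalDensity lam mu) :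
    ∃ M : ℝ, 0 ≤ M ∧ ∀ r ∈ Ioo 0 R, |δ r - η r| ≤ M * r ^ 2 := by
  obtain ⟨L, Fm, FM, hL, hFm, hF, -, -⟩ := exists_clamped_bounds hlam hmu hκ h1 hc
  have hFM : 0 < FM := hFm.trans_le ((hF 0 0).1.trans (hF 0 0).2)
  refine ⟨FM / 4, by positivity, ?_⟩
  have key := nonpos_of_deriv_nonpos_of_tendsto (R := R)
    (Q := fun r => r ^ 2 * (η r - δ r) - FM / 4 * r ^ 4)
    (Q' := fun r => (2 * r * (η r - δ r) + r ^ 2 * (3 * (δ r - η r) / r -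
      (-(shearCoeff lam mu (δ r) (η r) * (δ r - η r) / r)
        - r * gravityCoeff lam mu κ (δ r) (η r)))) - FM * r ^ 3) ?_ ?_ ?_
  · intro r hr
    have h2 := key r hr
    have h3 := h.density_le_mean r hr
    have hr2 : 0 < r ^ 2 := pow_pos hr.1 2
    rw [abs_sub_comm, abs_of_nonneg (by linarith)]
    have h4 : r ^ 2 * (η r - δ r) ≤ r ^ 2 * (FM / 4 * r ^ 2) := by
      have : r ^ 2 * (FM / 4 * r ^ 2) = FM / 4 * r ^ 4 := by ring
      linarith
    exact le_of_mul_le_mul_left h4 hr2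
  · intro r hr
    have hp4 := ((hasDerivAt_pow 4 r).const_mul (FM / 4))
    refine (((hasDerivAt_pow 2 r).mul ((h.hasDerivAt_mean r hr).sub
      (h.hasDerivAt_density r hr))).sub hp4).congr_deriv ?_
    norm_num
    ring
  · intro r hr
    have hb := shearCoeff_mem hlam hmu ((minDensity_pos hlam hmu).trans_le (h.density_mem r hr).1)
      (h.density_le_mean r hr) ((h.mean_mem r hr).2.trans_lt hc)
    have hFr := (hF (δ r) (η r)).2
    rw [clampedGravity_eq (h.density_mem r hr) (h.mean_mem r hr)] at hFr
    set b := shearCoeff lam mu (δ r) (η r)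
    set F := gravityCoeff lam mu κ (δ r) (η r)
    have hy := sub_nonneg.2 (h.density_le_mean r hr)
    have hr0 := hr.1
    have e1 : (2 * r * (η r - δ r) + r ^ 2 * (3 * (δ r - η r) / r -
        (-(b * (δ r - η r) / r) - r * F))) - FM * r ^ 3 =
        -(r * (η r - δ r) * (1 + b)) - r ^ 3 * (FM - F) := by
      field_simp
      ring
    rw [e1]
    have t1 : 0 ≤ r * (η r - δ r) * (1 + b) :=
      mul_nonneg (mul_nonneg hr0.le hy) (by linarith [hb.1])
    have t2 : 0 ≤ r ^ 3 * (FM - F) := mul_nonneg (by positivity) (by linarith)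
    linarith
  · have hid : Tendsto (fun r : ℝ => r) (𝓝[>] 0) (𝓝 0) := tendsto_id.mono_left nhdsWithin_le_nhds
    have := ((hid.pow 2).mul (h.tendsto_mean.sub h.tendsto_density)).sub
      ((hid.pow 4).const_mul (FM / 4))
    simpa using this

/-- The structure flow is determined by its central value. -/
theorem IsStructureFlow.eqOn {δ₁ η₁ δ₂ η₂ : ℝ → ℝ} (h₁ : IsStructureFlow lam mu κ δc R δ₁ η₁)
    (h₂ : IsStructureFlow lam mu κ δc R δ₂ η₂)
    (hlam : 0 < lam) (hmu : 0 ≤ mu) (hκ : 0 < κ) (h1 : 1 < δc) (hc : δc < criticalDensity lam mu) :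
    ∀ r ∈ Ioo 0 R, δ₁ r = δ₂ r ∧ η₁ r = η₂ r := by
  obtain ⟨M₁, hM₁, hd₁⟩ := h₁.exists_deficit_le hlam hmu hκ h1 hc
  obtain ⟨M₂, hM₂, hd₂⟩ := h₂.exists_deficit_le hlam hmu hκ h1 hc
  obtain ⟨L, Fm, FM, hL, -, -, hBL, hFL⟩ := exists_clamped_bounds hlam hmu hκ h1 hc
  rcases le_or_gt R 0 with hR | hR
  · intro r hr; exact absurd (hr.1.trans hr.2) (not_lt.2 hR)
  -- The 3 absorbs `2e · 3q`; the rest absorbs the Lipschitz differences of both coefficients, the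
  -- shear one being multiplied by `|(δ₂ - η₂)/r²| ≤ M₂`.
  set C : ℝ := 3 + 2 * ((M₂ + 1) * L) * (R + 1) with hC
  set e : ℝ → ℝ := fun r => η₁ r - η₂ r with he
  set q : ℝ → ℝ := fun r => ((δ₁ r - η₁ r) - (δ₂ r - η₂ r)) / r with hq
  set b₁ : ℝ → ℝ := fun r => shearCoeff lam mu (δ₁ r) (η₁ r) with hb₁
  set b₂ : ℝ → ℝ := fun r => shearCoeff lam mu (δ₂ r) (η₂ r) with hb₂
  set F₁ : ℝ → ℝ := fun r => gravityCoeff lam mu κ (δ₁ r) (η₁ r) with hF₁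
  set F₂ : ℝ → ℝ := fun r => gravityCoeff lam mu κ (δ₂ r) (η₂ r) with hF₂
  have hde : ∀ r ∈ Ioo 0 R, HasDerivAt e (3 * q r) r := by
    intro r hr
    refine ((h₁.hasDerivAt_mean r hr).sub (h₂.hasDerivAt_mean r hr)).congr_deriv ?_
    simp only [hq]
    ring
  have hdq : ∀ r ∈ Ioo 0 R, HasDerivAt q (-((4 + b₁ r) * q r / r)
      - (b₁ r - b₂ r) * ((δ₂ r - η₂ r) / r ^ 2) - (F₁ r - F₂ r)) r := by
    intro r hr
    have hr0 : r ≠ 0 := hr.1.ne'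
    refine ((((h₁.hasDerivAt_density r hr).sub (h₁.hasDerivAt_mean r hr)).sub
      ((h₂.hasDerivAt_density r hr).sub (h₂.hasDerivAt_mean r hr))).div
      (hasDerivAt_id r) hr0).congr_deriv ?_
    simp only [hq, hb₁, hb₂, hF₁, hF₂, Pi.sub_apply, id]
    field_simp
    ring
  have key := nonpos_of_deriv_nonpos_of_tendsto (R := R)
    (Q := fun r => (e r ^ 2 + q r ^ 2) * Real.exp (-C * r))
    (Q' := fun r => (2 * e r * (3 * q r) + 2 * q r * (-((4 + b₁ r) * q r / r)
      - ((b₁ r - b₂ r) * ((δ₂ r - η₂ r) / r ^ 2) + (F₁ r - F₂ r)))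
      - C * (e r ^ 2 + q r ^ 2)) * Real.exp (-C * r)) ?_ ?_ ?_
  · intro r hr
    have h3 := key r hr
    have h4 : e r ^ 2 + q r ^ 2 ≤ 0 := by
      by_contra! hpos
      exact absurd h3 (not_le.2 (mul_pos hpos (Real.exp_pos _)))
    have e0 : e r = 0 := by nlinarith [sq_nonneg (e r), sq_nonneg (q r)]
    have q0 : q r = 0 := by nlinarith [sq_nonneg (e r), sq_nonneg (q r)]
    simp only [he] at e0
    simp only [hq, div_eq_zero_iff, hr.1.ne', or_false] at q0
    constructor <;> linarith
  · intro r hr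
    refine ((((hde r hr).pow 2).add ((hdq r hr).pow 2)).mul
      (((hasDerivAt_id r).const_mul (-C)).exp)).congr_deriv ?_
    simp only [Pi.add_apply, Pi.pow_apply, id]
    push_cast
    ring
  · intro r hr
    have hr0 := hr.1
    have hb := shearCoeff_mem hlam hmu
      ((minDensity_pos hlam hmu).trans_le (h₁.density_mem r hr).1)
      (h₁.density_le_mean r hr) ((h₁.mean_mem r hr).2.trans_lt hc)
    have hD : |δ₁ r - δ₂ r| + |η₁ r - η₂ r| ≤ R * |q r| + 2 * |e r| := by
      have e1 : δ₁ r - δ₂ r = r * q r + e r := by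
        simp only [hq, he]; field_simp; ring
      have e2 : |δ₁ r - δ₂ r| ≤ R * |q r| + |e r| := by
        rw [e1]
        refine (abs_add_le _ _).trans ?_
        rw [abs_mul, abs_of_pos hr0]
        have := mul_le_mul_of_nonneg_right hr.2.le (abs_nonneg (q r))
        linarith
      have : |η₁ r - η₂ r| = |e r| := rfl
      linarith
    have hB : |b₁ r - b₂ r| ≤ L * (R * |q r| + 2 * |e r|) := by
      have := hBL (δ₁ r) (η₁ r) (δ₂ r) (η₂ r)
      rw [clampedShear_eq hlam hmu hc (h₁.density_mem r hr) (h₁.mean_mem r hr)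
        (h₁.density_le_mean r hr), clampedShear_eq hlam hmu hc (h₂.density_mem r hr)
        (h₂.mean_mem r hr) (h₂.density_le_mean r hr)] at this
      exact this.trans (mul_le_mul_of_nonneg_left hD hL)
    have hF : |F₁ r - F₂ r| ≤ L * (R * |q r| + 2 * |e r|) := by
      have := hFL (δ₁ r) (η₁ r) (δ₂ r) (η₂ r)
      rw [clampedGravity_eq (h₁.density_mem r hr) (h₁.mean_mem r hr),
        clampedGravity_eq (h₂.density_mem r hr) (h₂.mean_mem r hr)] at this
      exact this.trans (mul_le_mul_of_nonneg_left hD hL)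
    have hz : |(δ₂ r - η₂ r) / r ^ 2| ≤ M₂ := by
      rw [abs_div, abs_of_pos (pow_pos hr0 2), div_le_iff₀ (pow_pos hr0 2)]
      exact hd₂ r hr
    set G := (b₁ r - b₂ r) * ((δ₂ r - η₂ r) / r ^ 2) + (F₁ r - F₂ r) with hG
    have hGb : |G| ≤ (M₂ + 1) * L * (R * |q r| + 2 * |e r|) := by
      refine (abs_add_le _ _).trans ?_
      rw [abs_mul]
      have h0 : 0 ≤ L * (R * |q r| + 2 * |e r|) := by positivity
      have := mul_le_mul hB hz (abs_nonneg _) h0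
      nlinarith
    have hqG : -(2 * q r * G) ≤ 2 * ((M₂ + 1) * L) * (R + 1) * (e r ^ 2 + q r ^ 2) := by
      have a1 : -(q r * G) ≤ |q r| * |G| := by rw [← abs_mul]; exact neg_le_abs _
      have a2 := mul_le_mul_of_nonneg_left hGb (abs_nonneg (q r))
      have a3 : |q r| * (R * |q r| + 2 * |e r|) ≤ (R + 1) * (e r ^ 2 + q r ^ 2) := by
        have := sq_abs (q r)
        have := sq_abs (e r)
        nlinarith [sq_nonneg (|q r| - |e r|), mul_nonneg hR.le (sq_nonneg (e r))]
      have a4 : 0 ≤ (M₂ + 1) * L := by positivity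
      have a5 := mul_le_mul_of_nonneg_left a3 a4
      nlinarith
    -- The singular term enters the energy derivative as `-2(4 + b₁)q²/r`, which can be discarded
    -- because `b₁ ≥ -1/2`.
    have hdrop : 0 ≤ (4 + b₁ r) * q r ^ 2 / r :=
      div_nonneg (mul_nonneg (by have := hb.1; simp only [hb₁]; linarith) (sq_nonneg _)) hr0.le
    have heq : 2 * e r * (3 * q r) ≤ 3 * (e r ^ 2 + q r ^ 2) := by
      nlinarith [sq_nonneg (e r - q r)]
    have hW : 2 * e r * (3 * q r) + 2 * q r * (-((4 + b₁ r) * q r / r) - G) ≤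
        C * (e r ^ 2 + q r ^ 2) := by
      have : 2 * q r * (-((4 + b₁ r) * q r / r) - G) =
        -(2 * ((4 + b₁ r) * q r ^ 2 / r)) - 2 * q r * G := by ring
      rw [this, hC]
      nlinarith
    exact mul_nonpos_of_nonpos_of_nonneg (sub_nonpos.2 hW) (Real.exp_pos _).le
  · have hid : Tendsto (fun r : ℝ => r) (𝓝[>] 0) (𝓝 0) := tendsto_id.mono_left nhdsWithin_le_nhds
    have he0 : Tendsto e (𝓝[>] 0) (𝓝 0) := by
      simpa using h₁.tendsto_mean.sub h₂.tendsto_mean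
    have hq0 : Tendsto q (𝓝[>] 0) (𝓝 0) := by
      have hb : Tendsto (fun r : ℝ => (M₁ + M₂) * r) (𝓝[>] 0) (𝓝 0) := by
        simpa using hid.const_mul (M₁ + M₂)
      refine squeeze_zero_norm' ?_ hb
      filter_upwards [Ioo_mem_nhdsGT hR] with r hr
      have hr0 := hr.1
      rw [Real.norm_eq_abs, abs_div, abs_of_pos hr0, div_le_iff₀ hr0]
      refine (abs_sub _ _).trans ?_
      have := hd₁ r hr
      have := hd₂ r hr
      nlinarith
    have hexp : Tendsto (fun r : ℝ => Real.exp (-C * r)) (𝓝[>] 0) (𝓝 1) := by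
      have : Continuous fun r : ℝ => Real.exp (-C * r) := by fun_prop
      simpa using (this.tendsto 0).mono_left nhdsWithin_le_nhds
    simpa using ((he0.pow 2).add (hq0.pow 2)).mul hexp

end Flow

/-! ### Calculus of the mean compression. -/

section MeanDensity

variable {K R r : ℝ} {ρ ρ' : ℝ → ℝ}

lemma relDensity_pos (hK : 0 < K) (hρ : 0 < ρ r) : 0 < relDensity K ρ r := div_pos hρ hK

lemma enclosedMass_congr (h : EqOn ρ ρ' (Icc 0 R)) (hr : r ∈ Icc 0 R) :
    enclosedMass ρ r = enclosedMass ρ' r := by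
  unfold enclosedMass
  congr 1
  refine intervalIntegral.integral_congr fun s hs => ?_
  rw [uIcc_of_le hr.1] at hs
  simp only [h ⟨hs.1, hs.2.trans hr.2⟩]

lemma meanRelDensity_congr (h : EqOn ρ ρ' (Icc 0 R)) (hr : r ∈ Icc 0 R) :
    meanRelDensity K ρ r = meanRelDensity K ρ' r := by
  unfold meanRelDensity
  rw [enclosedMass_congr h hr]

/-- The density may jump at `R`; a globally continuous replacement with the same enclosed mass on
`[0, R]` avoids one-sided arguments. -/
lemma exists_continuous_eqOn (hR : 0 ≤ R) (h : ContinuousOn ρ (Icc 0 R)) :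
    ∃ ρ' : ℝ → ℝ, Continuous ρ' ∧ EqOn ρ ρ' (Icc 0 R) :=
  ⟨fun s => ρ (clamp 0 R s), h.comp_continuous (continuous_clamp 0 R) (clamp_mem hR),
    fun s hs => by simp only [clamp_of_mem hs]⟩

lemma enclosedMass_eq_mean (hK : 0 < K) (hr : 0 < r) :
    enclosedMass ρ r = 4 * Real.pi / 3 * K * meanRelDensity K ρ r * r ^ 3 := by
  unfold meanRelDensity
  field_simp

/-- The substitution `s = r τ` cancels `r³`, leaving an expression that is continuous at `r = 0`
when `ρ` is. -/
lemma meanRelDensity_eq_scaled (hK : 0 < K) (hr : 0 < r) :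
    meanRelDensity K ρ r = 3 / K * ∫ τ in (0 : ℝ)..1, ρ (r * τ) * τ ^ 2 := by
  have h := intervalIntegral.mul_integral_comp_mul_left (a := 0) (b := 1)
    (f := fun s => ρ s * s ^ 2) r
  simp only [mul_zero, mul_one] at h
  unfold meanRelDensity enclosedMass
  rw [← h]
  have : ∫ τ in (0 : ℝ)..1, ρ (r * τ) * (r * τ) ^ 2 =
      r ^ 2 * ∫ τ in (0 : ℝ)..1, ρ (r * τ) * τ ^ 2 := by
    rw [← intervalIntegral.integral_const_mul]
    congr 1
    ext τ
    ring
  rw [this]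
  have := Real.pi_pos
  field_simp

lemma continuous_scaledMean (h : Continuous ρ) :
    Continuous fun r => 3 / K * ∫ τ in (0 : ℝ)..1, ρ (r * τ) * τ ^ 2 := by
  refine continuous_const.mul
    (intervalIntegral.continuous_parametric_intervalIntegral_of_continuous' ?_ 0 1)
  simp only [Function.uncurry_def]
  fun_prop

lemma continuousOn_meanRelDensity (hK : 0 < K) (hR : 0 ≤ R) (h : ContinuousOn ρ (Icc 0 R)) :
    ContinuousOn (meanRelDensity K ρ) (Ioc 0 R) := by
  obtain ⟨ρ', hc, he⟩ := exists_continuous_eqOn hR h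
  refine (continuous_scaledMean (K := K) hc).continuousOn.congr fun r hr => ?_
  rw [meanRelDensity_congr he (Ioc_subset_Icc_self hr), meanRelDensity_eq_scaled hK hr.1]

lemma tendsto_meanRelDensity (hK : 0 < K) (hR : 0 < R) (h : ContinuousOn ρ (Icc 0 R)) :
    Tendsto (meanRelDensity K ρ) (𝓝[>] 0) (𝓝 (ρ 0 / K)) := by
  obtain ⟨ρ', hc, he⟩ := exists_continuous_eqOn hR.le h
  have ht := ((continuous_scaledMean (K := K) hc).tendsto 0).mono_left
    (nhdsWithin_le_nhds (s := Ioi 0))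
  have h0 : 3 / K * ∫ τ in (0 : ℝ)..1, ρ' (0 * τ) * τ ^ 2 = ρ 0 / K := by
    rw [he ⟨le_rfl, hR.le⟩]
    simp only [zero_mul]
    rw [intervalIntegral.integral_const_mul, integral_pow]
    push_cast
    ring
  rw [h0] at ht
  refine ht.congr' ?_
  filter_upwards [Ioo_mem_nhdsGT hR] with r hr
  rw [meanRelDensity_congr he (Ioo_subset_Icc_self hr), meanRelDensity_eq_scaled hK hr.1]

lemma hasDerivAt_meanRelDensity (hK : 0 < K) (h : ContinuousOn ρ (Icc 0 R)) (hr : r ∈ Ioo 0 R) :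
    HasDerivAt (meanRelDensity K ρ) (3 * (relDensity K ρ r - meanRelDensity K ρ r) / r) r := by
  obtain ⟨ρ', hc, he⟩ := exists_continuous_eqOn (hr.1.trans hr.2).le h
  have hr0 : r ≠ 0 := hr.1.ne'
  have hpi := Real.pi_pos
  have hden : 4 * Real.pi / 3 * K * r ^ 3 ≠ 0 := by positivity
  have hm : HasDerivAt (enclosedMass ρ') (4 * Real.pi * (ρ' r * r ^ 2)) r :=
    ((hc.mul (continuous_pow 2)).integral_hasStrictDerivAt 0 r).hasDerivAt.const_mul _
  have hq := hm.div ((hasDerivAt_pow 3 r).const_mul (4 * Real.pi / 3 * K)) hden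
  refine (hq.congr_of_eventuallyEq ?_).congr_deriv ?_
  · filter_upwards [Ioo_mem_nhds hr.1 hr.2] with s hs
    exact meanRelDensity_congr he (Ioo_subset_Icc_self hs)
  · rw [meanRelDensity_congr he (Ioo_subset_Icc_self hr)]
    unfold relDensity meanRelDensity
    rw [he (Ioo_subset_Icc_self hr)]
    field_simp
    norm_num
    ring

lemma meanRelDensity_le (hK : 0 < K) (h : ContinuousOn ρ (Icc 0 R)) (hr : r ∈ Ioc 0 R) {C : ℝ}
    (hC : ∀ s ∈ Icc 0 r, ρ s ≤ C) : meanRelDensity K ρ r ≤ C / K := by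
  obtain ⟨ρ', hc, he⟩ := exists_continuous_eqOn (hr.1.le.trans hr.2) h
  rw [meanRelDensity_congr he (Ioc_subset_Icc_self hr), meanRelDensity_eq_scaled hK hr.1]
  have h1 : ∫ τ in (0 : ℝ)..1, ρ' (r * τ) * τ ^ 2 ≤ ∫ τ in (0 : ℝ)..1, C * τ ^ 2 := by
    refine intervalIntegral.integral_mono_on zero_le_one
      (Continuous.intervalIntegrable (by fun_prop) _ _)
      (Continuous.intervalIntegrable (by fun_prop) _ _) fun τ hτ => ?_
    have hm : r * τ ∈ Icc 0 r :=
      ⟨mul_nonneg hr.1.le hτ.1, mul_le_of_le_one_right hr.1.le hτ.2⟩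
    rw [← he ⟨hm.1, hm.2.trans hr.2⟩]
    exact mul_le_mul_of_nonneg_right (hC _ hm) (sq_nonneg τ)
  rw [intervalIntegral.integral_const_mul, integral_pow] at h1
  calc _ ≤ 3 / K * (C * ((1 ^ (2 + 1) - 0 ^ (2 + 1)) / ((2 : ℕ) + 1))) := by gcongr
    _ = C / K := by push_cast; ring

lemma meanRelDensity_neg : meanRelDensity K (fun s => -ρ s) r = -meanRelDensity K ρ r := by
  simp [meanRelDensity, enclosedMass, neg_div]

lemma le_meanRelDensity (hK : 0 < K) (h : ContinuousOn ρ (Icc 0 R)) (hr : r ∈ Ioc 0 R) {C : ℝ}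
    (hC : ∀ s ∈ Icc 0 r, C ≤ ρ s) : C / K ≤ meanRelDensity K ρ r := by
  have := meanRelDensity_le hK h.neg hr (C := -C) fun s hs => neg_le_neg (hC s hs)
  have e : meanRelDensity K (-ρ) r = -meanRelDensity K ρ r := meanRelDensity_neg
  rw [e, neg_div] at this
  linarith

lemma meanRelDensity_pos (hK : 0 < K) (h : ContinuousOn ρ (Icc 0 R)) (hr : r ∈ Ioc 0 R)
    (hpos : ∀ s ∈ Ioo 0 R, 0 < ρ s) : 0 < meanRelDensity K ρ r := by
  obtain ⟨ρ', hc, he⟩ := exists_continuous_eqOn (hr.1.le.trans hr.2) h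
  rw [meanRelDensity_congr he (Ioc_subset_Icc_self hr)]
  unfold meanRelDensity enclosedMass
  have hpi := Real.pi_pos
  have hr0 := hr.1
  have : 0 < ∫ s in (0 : ℝ)..r, ρ' s * s ^ 2 := by
    refine intervalIntegral.intervalIntegral_pos_of_pos_on
      (Continuous.intervalIntegrable (by fun_prop) _ _) (fun s hs => ?_) hr0
    have hs' : s ∈ Ioo 0 R := ⟨hs.1, hs.2.trans_le hr.2⟩
    have := hpos s hs'
    rw [he (Ioo_subset_Icc_self hs')] at this
    have := hs.1
    positivity
  positivity

end MeanDensity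

/-! ### A priori properties of regular balls. -/

section RegularBall

variable {K R lam mu : ℝ} {ρ prad ptan : ℝ → ℝ}

lemma IsRegularBall.rho_pos (h : IsRegularBall ρ prad ptan R) : ∀ r ∈ Ioo 0 R, 0 < ρ r := by
  intro r hr
  rw [← h.support] at hr
  exact (interior_subset hr).2

lemma IsRegularBall.eventually_mem (h : IsRegularBall ρ prad ptan R) :
    ∀ᶠ r in 𝓝[>] (0 : ℝ), r ∈ Ioo 0 R := Ioo_mem_nhdsGT h.radius_pos

lemma tendsto_center {f : ℝ → ℝ} (hR : 0 < R) (hf : ContinuousOn f (Icc 0 R)) :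
    Tendsto f (𝓝[>] 0) (𝓝 (f 0)) := by
  have := (hf 0 ⟨le_rfl, hR.le⟩).tendsto
  refine this.mono_left ?_
  rw [← nhdsWithin_Ioo_eq_nhdsGT hR]
  exact nhdsWithin_mono _ Ioo_subset_Icc_self

lemma tendsto_boundary {f : ℝ → ℝ} (hR : 0 < R) (hf : ContinuousOn f (Ioc 0 R)) :
    Tendsto f (𝓝[<] R) (𝓝 (f R)) := by
  have := (hf R ⟨hR, le_rfl⟩).tendsto
  refine this.mono_left ?_
  rw [← nhdsWithin_Ioo_eq_nhdsLT hR]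
  exact nhdsWithin_mono _ Ioo_subset_Ioc_self

lemma IsRegularElasticBall.prad_eq
    (h : IsRegularElasticBall K (hadamardRad lam mu) (hadamardTan lam mu) ρ prad ptan R) {r : ℝ}
    (hr : r ∈ Ioc 0 R) (hρ : 0 < ρ r) :
    prad r = radPressure lam mu (relDensity K ρ r) (meanRelDensity K ρ r) := by
  have hK := h.2.refDensity_pos
  rw [h.2.rad_eq r hr.1 hρ, hadamardRad_eq (relDensity_pos hK hρ)
    (meanRelDensity_pos hK h.1.cont_rho hr h.1.rho_pos)]

lemma IsRegularElasticBall.ptan_eq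
    (h : IsRegularElasticBall K (hadamardRad lam mu) (hadamardTan lam mu) ρ prad ptan R) {r : ℝ}
    (hr : r ∈ Ioc 0 R) (hρ : 0 < ρ r) :
    ptan r = tanPressure lam mu (relDensity K ρ r) (meanRelDensity K ρ r) := by
  have hK := h.2.refDensity_pos
  rw [h.2.tan_eq r hr.1 hρ, hadamardTan_eq (relDensity_pos hK hρ)
    (meanRelDensity_pos hK h.1.cont_rho hr h.1.rho_pos)]

/-- The central density does not vanish. -/
lemma IsRegularElasticBall.rho_zero_pos (hlam : 0 < lam) (hmu : 0 ≤ mu)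
    (h : IsRegularElasticBall K (hadamardRad lam mu) (hadamardTan lam mu) ρ prad ptan R) :
    0 < ρ 0 := by
  have hR := h.1.radius_pos
  have hK := h.2.refDensity_pos
  have hρt := tendsto_center hR h.1.cont_rho
  have hρ0 : 0 ≤ ρ 0 := by
    refine ge_of_tendsto hρt ?_
    filter_upwards [h.1.eventually_mem] with r hr using (h.1.rho_pos r hr).le
  -- Suppose `ρ(0) = 0` and put `u = η^(2/3) → 0`. The limit of `p_rad` gives `u/δ → β`, and
  -- equality of the central pressures then gives `uδ/η² → β`. The product of these quantities with
  -- `u` is `u³/η² = 1`, yet it tends to `β² · 0`.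
  refine hρ0.lt_of_ne fun h0 => ?_
  have hηt := tendsto_meanRelDensity hK hR h.1.cont_rho
  rw [← h0, zero_div] at hηt
  set δ := relDensity K ρ with hδ
  set η := meanRelDensity K ρ with hη
  set u : ℝ → ℝ := fun r => η r ^ (2 / 3 : ℝ) with hu
  have hut : Tendsto u (𝓝[>] 0) (𝓝 0) := by
    have := hηt.rpow_const (p := (2 / 3 : ℝ)) (Or.inr (by norm_num))
    rwa [Real.zero_rpow (by norm_num)] at this
  have hpos : ∀ᶠ r in 𝓝[>] (0 : ℝ), 0 < δ r ∧ 0 < η r ∧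
      prad r = radPressure lam mu (δ r) (η r) ∧ ptan r = tanPressure lam mu (δ r) (η r) := by
    filter_upwards [h.1.eventually_mem] with r hr
    have hr' := Ioo_subset_Ioc_self hr
    have hρr := h.1.rho_pos r hr
    exact ⟨div_pos hρr hK, meanRelDensity_pos hK h.1.cont_rho hr' h.1.rho_pos,
      h.prad_eq hr' hρr, h.ptan_eq hr' hρr⟩
  have hpr := tendsto_center hR h.1.cont_prad
  have hpt := tendsto_center hR h.1.cont_ptan
  rw [← h.1.isotropic_center] at hpt
  have ha : 0 < lam + mu := by positivity
  set β := (lam + 2 * mu - prad 0) / (2 * (lam + mu) - lam * 0)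
  have hs4 (r) (hr : 0 < η r) : η r ^ (4 / 3 : ℝ) = u r ^ 2 := by
    simp only [hu]
    rw [← Real.rpow_mul_natCast hr.le]; norm_num
  have hs2 (r) (hr : 0 < η r) : u r * (u r * u r) = η r ^ 2 := by
    simp only [hu]
    rw [← Real.rpow_add hr, ← Real.rpow_add hr, ← Real.rpow_natCast]; norm_num
  have t1 : Tendsto (fun r => u r / δ r) (𝓝[>] 0) (𝓝 β) := by
    have hden : Tendsto (fun r => 2 * (lam + mu) - lam * u r) (𝓝[>] 0)
      (𝓝 (2 * (lam + mu) - lam * 0)) := (hut.const_mul lam).const_sub _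
    refine ((hpr.const_sub (lam + 2 * mu)).div hden (by simp; exact ha.ne')).congr' ?_
    filter_upwards [hpos, hut.eventually_lt_const (div_pos ha hlam)] with r ⟨h1, h2, h3, _⟩ h5
    rw [lt_div_iff₀ hlam] at h5
    have h6 : 2 * (lam + mu) - lam * u r ≠ 0 := by nlinarith
    simp only [Pi.div_apply]
    rw [h3, div_eq_iff h6]
    unfold radPressure radProfile
    rw [hs4 r h2]
    change _ - (_ - (2 * (lam + mu) * u r - _) / _) = _
    field_simp
    ring
  have t2 : Tendsto (fun r => u r / δ r - u r * δ r / η r ^ 2) (𝓝[>] 0) (𝓝 0) := by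
    have hden : Tendsto (fun r => (lam + mu) - lam * u r) (𝓝[>] 0)
      (𝓝 ((lam + mu) - lam * 0)) := (hut.const_mul lam).const_sub _
    have := (hpt.sub hpr).div hden (by simp; exact ha.ne')
    rw [sub_self, zero_div] at this
    refine this.congr' ?_
    filter_upwards [hpos, hut.eventually_lt_const (div_pos ha hlam)] with r ⟨h1, h2, h3, h4⟩ h5
    rw [lt_div_iff₀ hlam] at h5
    have h6 : (lam + mu) - lam * u r ≠ 0 := by nlinarith
    simp only [Pi.div_apply]
    rw [h3, h4, div_eq_iff h6]
    unfold tanPressure shearProfile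
    rw [hs4 r h2]
    change _ + ((lam + mu) * u r - _) * _ - _ = _
    field_simp
    ring
  have t3 : Tendsto (fun r => u r * δ r / η r ^ 2) (𝓝[>] 0) (𝓝 β) := by
    simpa using t1.sub t2
  have t4 := (t1.mul t3).mul hut
  rw [mul_zero] at t4
  have t5 : Tendsto (fun _ : ℝ => (1 : ℝ)) (𝓝[>] 0) (𝓝 0) := by
    refine t4.congr' ?_
    filter_upwards [hpos] with r ⟨h1, h2, _, _⟩
    have : u r / δ r * (u r * δ r / η r ^ 2) * u r = u r * (u r * u r) / η r ^ 2 := by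
      field_simp
    rw [this, hs2 r h2]
    field_simp
  exact one_ne_zero (tendsto_nhds_unique tendsto_const_nhds t5)

/-- Both compressions tend to `ρ(0)/K > 0`, where the constitutive law is continuous, so the
positive central pressure is the diagonal value, whose sign is that of `ρ(0)/K - 1`. -/
theorem IsRegularElasticBall.one_lt_central (hlam : 0 < lam) (hmu : 0 ≤ mu)
    (h : IsRegularElasticBall K (hadamardRad lam mu) (hadamardTan lam mu) ρ prad ptan R) :
    1 < ρ 0 / K := by
  have hR := h.1.radius_pos
  have hK := h.2.refDensity_pos
  have hs : 0 < ρ 0 / K := div_pos (h.rho_zero_pos hlam hmu) hK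
  rw [← radPressure_self_pos_iff hlam hmu hs]
  have hδt : Tendsto (relDensity K ρ) (𝓝[>] 0) (𝓝 (ρ 0 / K)) :=
    (tendsto_center hR h.1.cont_rho).div_const K
  have hηt := tendsto_meanRelDensity hK hR h.1.cont_rho
  have hc : Tendsto (fun q : ℝ × ℝ => radPressure lam mu q.1 q.2) (𝓝 (ρ 0 / K, ρ 0 / K))
      (𝓝 (radPressure lam mu (ρ 0 / K) (ρ 0 / K))) :=
    (contDiffAt_radPressure (q := (ρ 0 / K, ρ 0 / K)) hs hs).continuousAt
  have ht := hc.comp (hδt.prodMk_nhds hηt)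
  have he : Tendsto prad (𝓝[>] 0) (𝓝 (radPressure lam mu (ρ 0 / K) (ρ 0 / K))) := by
    refine ht.congr' ?_
    filter_upwards [h.1.eventually_mem] with r hr
    exact (h.prad_eq (Ioo_subset_Ioc_self hr) (h.1.rho_pos r hr)).symm
  rw [tendsto_nhds_unique he (tendsto_center hR h.1.cont_prad)]
  exact h.1.prad_pos 0 ⟨le_rfl, hR⟩

/-- The equation for `δ'` at points of the ball where `η` is subcritical. -/
lemma IsRegularElasticBall.hasDerivAt_relDensity
    (h : IsRegularElasticBall K (hadamardRad lam mu) (hadamardTan lam mu) ρ prad ptan R) {r : ℝ}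
    (hr : r ∈ Ioo 0 R) (hh : 0 < radProfile lam mu (meanRelDensity K ρ r)) :
    HasDerivAt (relDensity K ρ)
      (-(shearCoeff lam mu (relDensity K ρ r) (meanRelDensity K ρ r)
          * (relDensity K ρ r - meanRelDensity K ρ r) / r)
        - r * gravityCoeff lam mu (4 * Real.pi / 3 * K ^ 2) (relDensity K ρ r)
          (meanRelDensity K ρ r)) r := by
  have hK := h.2.refDensity_pos
  have hr' := Ioo_subset_Ioc_self hr
  have hρ := h.1.rho_pos r hr
  have hδ : 0 < relDensity K ρ r := div_pos hρ hK
  have hη := meanRelDensity_pos hK h.1.cont_rho hr' h.1.rho_pos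
  have hdiff : DifferentiableAt ℝ (relDensity K ρ) r :=
    (((h.1.contDiff_rho.contDiffAt (Ioc_mem_nhds hr.1 hr.2)).differentiableAt
      (by norm_num)).div_const K)
  have hd := hdiff.hasDerivAt
  have hP := hasDerivAt_radPressure_comp (lam := lam) (mu := mu) hδ hη hd
    (hasDerivAt_meanRelDensity hK h.1.cont_rho hr)
  have hE := (h.1.equilibrium r hr).congr_of_eventuallyEq (f₁ := fun s =>
      radPressure lam mu (relDensity K ρ s) (meanRelDensity K ρ s)) (by
    filter_upwards [Ioo_mem_nhds hr.1 hr.2] with s hs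
    exact (h.prad_eq (Ioo_subset_Ioc_self hs) (h.1.rho_pos s hs)).symm)
  have hu := hP.unique hE
  rw [h.prad_eq hr' hρ, h.ptan_eq hr' hρ, enclosedMass_eq_mean hK hr.1] at hu
  have hgrav : ρ r * (4 * Real.pi / 3 * K * meanRelDensity K ρ r * r ^ 3 / r ^ 2) =
      4 * Real.pi / 3 * K ^ 2 * relDensity K ρ r * meanRelDensity K ρ r * r := by
    have := hr.1.ne'
    unfold relDensity
    field_simp
  rw [hgrav] at hu
  rw [← (equilibrium_iff hr.1 hδ hη hh).1 hu]
  exact hd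

lemma density_rhs_nonpos {κ d e r : ℝ} (hlam : 0 < lam) (hmu : 0 ≤ mu) (hκ : 0 < κ) (hr : 0 < r)
    (hd : 0 < d) (he : 0 < e) (hc : e < criticalDensity lam mu) :
    -(shearCoeff lam mu d e * (d - e) / r) - r * gravityCoeff lam mu κ d e ≤ 0 := by
  have hg := shearProfile_pos hlam hmu he hc
  have hh := radProfile_pos hlam hmu he hc
  have h1 : 0 ≤ shearCoeff lam mu d e * (d - e) / r := by
    unfold shearCoeff
    rw [div_mul_eq_mul_div, mul_assoc, ← sq]
    positivity
  have h2 : 0 ≤ r * gravityCoeff lam mu κ d e := by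
    unfold gravityCoeff
    positivity
  linarith

lemma IsRegularElasticBall.antitoneOn_relDensity (hlam : 0 < lam) (hmu : 0 ≤ mu)
    (h : IsRegularElasticBall K (hadamardRad lam mu) (hadamardTan lam mu) ρ prad ptan R) {r₁ : ℝ}
    (hr₁ : r₁ ≤ R) (hc : ∀ r ∈ Ioo 0 r₁, meanRelDensity K ρ r < criticalDensity lam mu) :
    AntitoneOn (relDensity K ρ) (Icc 0 r₁) := by
  have hK := h.2.refDensity_pos
  have hder : ∀ r ∈ Ioo 0 r₁, _ := fun r hr =>
    have hrR : r ∈ Ioo 0 R := ⟨hr.1, hr.2.trans_le hr₁⟩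
    h.hasDerivAt_relDensity hrR (radProfile_pos hlam hmu (meanRelDensity_pos hK h.1.cont_rho
      (Ioo_subset_Ioc_self hrR) h.1.rho_pos) (hc r hr))
  refine antitoneOn_of_deriv_nonpos (convex_Icc 0 r₁)
    ((h.1.cont_rho.mono (Icc_subset_Icc_right hr₁)).div_const K) ?_ ?_
  · rw [interior_Icc]
    exact fun r hr => (hder r hr).differentiableAt.differentiableWithinAt
  · rw [interior_Icc]
    intro r hr
    have hrR : r ∈ Ioo 0 R := ⟨hr.1, hr.2.trans_le hr₁⟩
    rw [(hder r hr).deriv]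
    exact density_rhs_nonpos hlam hmu (by have := Real.pi_pos; positivity) hr.1
      (div_pos (h.1.rho_pos r hrR) hK) (meanRelDensity_pos hK h.1.cont_rho
      (Ioo_subset_Ioc_self hrR) h.1.rho_pos) (hc r hr)

/-- A continuation argument: up to the first radius where `η` reaches the critical value the density
decreases, so the mean there is at most the central value, which is subcritical. -/
lemma IsRegularElasticBall.mean_lt_critical (hlam : 0 < lam) (hmu : 0 ≤ mu)
    (h : IsRegularElasticBall K (hadamardRad lam mu) (hadamardTan lam mu) ρ prad ptan R)
    (hcrit : ρ 0 / K < criticalDensity lam mu) :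
    ∀ r ∈ Ioc 0 R, meanRelDensity K ρ r < criticalDensity lam mu := by
  have hR := h.1.radius_pos
  have hK := h.2.refDensity_pos
  intro r₁ hr₁
  by_contra! hbad
  -- At `r = 0` the quotient defining `η` has the default value 0, so the search for a first bad
  -- radius starts at a positive `ε`, below which the central limit controls `η`.
  obtain ⟨ε, hε, hεlt⟩ : ∃ ε > 0, ∀ r ∈ Ioo 0 ε, meanRelDensity K ρ r < criticalDensity lam mu := by
    have := (tendsto_meanRelDensity hK hR h.1.cont_rho).eventually_lt_const hcrit
    obtain ⟨ε, hε, hsub⟩ := (mem_nhdsGT_iff_exists_Ioo_subset).1 this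
    exact ⟨ε, hε, fun r hr => hsub hr⟩
  have hε1 : ε ≤ r₁ := by
    by_contra! hlt
    exact absurd (hεlt r₁ ⟨hr₁.1, hlt⟩) (not_lt.2 hbad)
  set S := Icc ε r₁ ∩ meanRelDensity K ρ ⁻¹' Ici (criticalDensity lam mu) with hS
  have hcompact : IsCompact S := by
    refine isCompact_Icc.of_isClosed_subset ?_ inter_subset_left
    exact ((continuousOn_meanRelDensity hK hR.le h.1.cont_rho).mono fun s hs =>
      ⟨hε.trans_le hs.1, hs.2.trans hr₁.2⟩).preimage_isClosed_of_isClosed isClosed_Icc isClosed_Ici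
  obtain ⟨r₂, hr₂, hmin⟩ := hcompact.exists_isLeast ⟨r₁, ⟨hε1, le_rfl⟩, hbad⟩
  have hr₂0 : 0 < r₂ := hε.trans_le hr₂.1.1
  have hr₂R : r₂ ≤ R := hr₂.1.2.trans hr₁.2
  have hlt : ∀ r ∈ Ioo 0 r₂, meanRelDensity K ρ r < criticalDensity lam mu := by
    intro r hr
    rcases lt_or_ge r ε with hrε | hrε
    · exact hεlt r ⟨hr.1, hrε⟩
    · by_contra! hge
      exact absurd (hmin ⟨⟨hrε, hr.2.le.trans hr₂.1.2⟩, hge⟩) (not_le.2 hr.2)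
  have hanti := h.antitoneOn_relDensity hlam hmu hr₂R hlt
  have hle := meanRelDensity_le hK h.1.cont_rho ⟨hr₂0, hr₂R⟩ (C := ρ 0) fun s hs => by
    have := hanti ⟨le_rfl, hr₂0.le⟩ hs hs.1
    exact (div_le_div_iff_of_pos_right hK).1 this
  exact absurd (hle.trans_lt hcrit) (not_lt.2 hr₂.2)

/-- The profiles of a regular ball of the Hadamard material follow the structure flow. -/
theorem IsRegularElasticBall.isStructureFlow (hlam : 0 < lam) (hmu : 0 ≤ mu)
    (h : IsRegularElasticBall K (hadamardRad lam mu) (hadamardTan lam mu) ρ prad ptan R)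
    (hcrit : ρ 0 / K < criticalDensity lam mu) :
    IsStructureFlow lam mu (4 * Real.pi / 3 * K ^ 2) (ρ 0 / K) R (relDensity K ρ)
      (meanRelDensity K ρ) := by
  have hR := h.1.radius_pos
  have hK := h.2.refDensity_pos
  have hlt := h.mean_lt_critical hlam hmu hcrit
  have hpos := fun r (hr : r ∈ Ioo 0 R) =>
    meanRelDensity_pos hK h.1.cont_rho (Ioo_subset_Ioc_self hr) h.1.rho_pos
  have hanti := h.antitoneOn_relDensity hlam hmu le_rfl fun r hr => hlt r (Ioo_subset_Ioc_self hr)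
  have hle : ∀ r ∈ Ioo 0 R, relDensity K ρ r ≤ ρ 0 / K := fun r hr =>
    hanti ⟨le_rfl, hR.le⟩ (Ioo_subset_Icc_self hr) hr.1.le
  have hlm : ∀ r ∈ Ioo 0 R, relDensity K ρ r ≤ meanRelDensity K ρ r := fun r hr =>
    le_meanRelDensity hK h.1.cont_rho (Ioo_subset_Ioc_self hr) fun s hs =>
      (div_le_div_iff_of_pos_right hK).1
        (hanti ⟨hs.1, hs.2.trans hr.2.le⟩ (Ioo_subset_Icc_self hr) hs.2)
  have hprof : ∀ r ∈ Ioo 0 R,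
      radProfile lam mu (meanRelDensity K ρ r) < (lam + 2 * mu) * relDensity K ρ r := by
    intro r hr
    have := h.1.prad_pos r ⟨hr.1.le, hr.2⟩
    rw [h.prad_eq (Ioo_subset_Ioc_self hr) (h.1.rho_pos r hr), radPressure, sub_pos,
      div_lt_iff₀ (relDensity_pos hK (h.1.rho_pos r hr))] at this
    exact this
  -- Positive pressure and `δ ≤ η` give `h(η) < (λ + 2μ) η`, which forces `η > 1`.
  have hone : ∀ r ∈ Ioo 0 R, 1 < meanRelDensity K ρ r := fun r hr =>
    (radProfile_lt_iff hlam hmu (hpos r hr)).1 ((hprof r hr).trans_le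
      (mul_le_mul_of_nonneg_left (hlm r hr) (by positivity)))
  refine ⟨fun r hr => hasDerivAt_meanRelDensity hK h.1.cont_rho hr,
    fun r hr => h.hasDerivAt_relDensity hr (radProfile_pos hlam hmu (hpos r hr)
      (hlt r (Ioo_subset_Ioc_self hr))), fun r hr => ⟨?_, hle r hr⟩, fun r hr => ⟨(hone r hr).le, ?_⟩,
    hlm, (tendsto_center hR h.1.cont_rho).div_const K, tendsto_meanRelDensity hK hR h.1.cont_rho⟩
  · have h1 := lt_radProfile hlam hmu (hone r hr).le (hlt r (Ioo_subset_Ioc_self hr))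
    unfold minDensity
    rw [div_le_iff₀ (by positivity)]
    linarith [hprof r hr]
  · exact meanRelDensity_le hK h.1.cont_rho (Ioo_subset_Ioc_self hr) fun s hs =>
      (div_le_div_iff_of_pos_right hK).1
        (hanti ⟨le_rfl, hR.le⟩ ⟨hs.1, hs.2.trans hr.2.le⟩ hs.1)

end RegularBall

/-! ### Uniqueness of the ball with given central density. -/

section Uniqueness

variable {K R R₁ R₂ lam mu : ℝ} {ρ prad ptan ρ₁ prad₁ ptan₁ ρ₂ prad₂ ptan₂ : ℝ → ℝ}

lemma IsStructureFlow.mono {κ δc : ℝ} {δ η : ℝ → ℝ} (h : IsStructureFlow lam mu κ δc R₁ δ η)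
    (hR : R₂ ≤ R₁) : IsStructureFlow lam mu κ δc R₂ δ η where
  hasDerivAt_mean r hr := h.hasDerivAt_mean r ⟨hr.1, hr.2.trans_le hR⟩
  hasDerivAt_density r hr := h.hasDerivAt_density r ⟨hr.1, hr.2.trans_le hR⟩
  density_mem r hr := h.density_mem r ⟨hr.1, hr.2.trans_le hR⟩
  mean_mem r hr := h.mean_mem r ⟨hr.1, hr.2.trans_le hR⟩
  density_le_mean r hr := h.density_le_mean r ⟨hr.1, hr.2.trans_le hR⟩
  tendsto_density := h.tendsto_density
  tendsto_mean := h.tendsto_mean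

/-- The material law is assumed only where `ρ > 0`; positivity at `R` makes it available on the
boundary itself. -/
lemma IsRegularElasticBall.rho_boundary_pos (hlam : 0 < lam) (hmu : 0 ≤ mu)
    (h : IsRegularElasticBall K (hadamardRad lam mu) (hadamardTan lam mu) ρ prad ptan R)
    (hcrit : ρ 0 / K < criticalDensity lam mu) : 0 < ρ R := by
  have hR := h.1.radius_pos
  have hK := h.2.refDensity_pos
  have hflow := h.isStructureFlow hlam hmu hcrit
  have ht : Tendsto (relDensity K ρ) (𝓝[<] R) (𝓝 (relDensity K ρ R)) :=
    (tendsto_boundary hR (h.1.cont_rho.mono Ioc_subset_Icc_self)).div_const K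
  have hle : minDensity lam mu ≤ relDensity K ρ R := by
    refine ge_of_tendsto ht ?_
    filter_upwards [Ioo_mem_nhdsLT hR] with r hr using (hflow.density_mem r hr).1
  have := (minDensity_pos hlam hmu).trans_le hle
  unfold relDensity at this
  exact (div_pos_iff_of_pos_right hK).1 this

lemma IsRegularElasticBall.eqOn_Ioc (hlam : 0 < lam) (hmu : 0 ≤ mu)
    (h₁ : IsRegularElasticBall K (hadamardRad lam mu) (hadamardTan lam mu) ρ₁ prad₁ ptan₁ R₁)
    (h₂ : IsRegularElasticBall K (hadamardRad lam mu) (hadamardTan lam mu) ρ₂ prad₂ ptan₂ R₂)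
    (h0 : ρ₁ 0 = ρ₂ 0) (hcrit : ρ₂ 0 / K < criticalDensity lam mu) (hR : R₂ ≤ R₁) :
    ∀ r ∈ Ioc 0 R₂, relDensity K ρ₁ r = relDensity K ρ₂ r ∧
      meanRelDensity K ρ₁ r = meanRelDensity K ρ₂ r := by
  have hK := h₁.2.refDensity_pos
  have hR₂ := h₂.1.radius_pos
  have hf₁ := (h₁.isStructureFlow hlam hmu (h0 ▸ hcrit)).mono hR
  have hf₂ := h₂.isStructureFlow hlam hmu hcrit
  rw [h0] at hf₁
  have heq := hf₁.eqOn hf₂ hlam hmu (by have := Real.pi_pos; positivity)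
    (h₂.one_lt_central hlam hmu) hcrit
  intro r hr
  rcases hr.2.lt_or_eq with hlt | rfl
  · exact heq r ⟨hr.1, hlt⟩
  have hsub : Ioc 0 r ⊆ Ioc 0 R₁ := Ioc_subset_Ioc_right hR
  have hev : ∀ᶠ s in 𝓝[<] r, s ∈ Ioo 0 r := Ioo_mem_nhdsLT hr.1
  constructor
  · have t₁ := (tendsto_boundary hr.1
      (h₁.1.cont_rho.mono (hsub.trans Ioc_subset_Icc_self))).div_const K
    have t₂ := (tendsto_boundary hr.1 (h₂.1.cont_rho.mono Ioc_subset_Icc_self)).div_const K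
    refine tendsto_nhds_unique (t₁.congr' ?_) t₂
    filter_upwards [hev] with s hs using (heq s hs).1
  · have t₁ := tendsto_boundary hr.1
      ((continuousOn_meanRelDensity hK h₁.1.radius_pos.le h₁.1.cont_rho).mono hsub)
    have t₂ := tendsto_boundary hr.1 (continuousOn_meanRelDensity hK hR₂.le h₂.1.cont_rho)
    refine tendsto_nhds_unique (t₁.congr' ?_) t₂
    filter_upwards [hev] with s hs using (heq s hs).2

/-- If `R₂ < R₁`, both balls have the same compressions at `R₂`, hence the same radial pressure; it
is zero for the smaller ball and positive inside the larger one. -/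
lemma IsRegularElasticBall.radius_le (hlam : 0 < lam) (hmu : 0 ≤ mu)
    (h₁ : IsRegularElasticBall K (hadamardRad lam mu) (hadamardTan lam mu) ρ₁ prad₁ ptan₁ R₁)
    (h₂ : IsRegularElasticBall K (hadamardRad lam mu) (hadamardTan lam mu) ρ₂ prad₂ ptan₂ R₂)
    (h0 : ρ₁ 0 = ρ₂ 0) (hcrit : ρ₂ 0 / K < criticalDensity lam mu) : R₁ ≤ R₂ := by
  by_contra! hlt
  have hR₂ := h₂.1.radius_pos
  have hm : R₂ ∈ Ioc 0 R₂ := ⟨hR₂, le_rfl⟩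
  have he := h₁.eqOn_Ioc hlam hmu h₂ h0 hcrit hlt.le R₂ hm
  have e₁ := h₁.prad_eq ⟨hR₂, hlt.le⟩ (h₁.1.rho_pos R₂ ⟨hR₂, hlt⟩)
  have e₂ := h₂.prad_eq hm (h₂.rho_boundary_pos hlam hmu hcrit)
  rw [he.1, he.2, ← e₂, h₂.1.prad_boundary] at e₁
  exact absurd e₁ (h₁.1.prad_pos R₂ ⟨hR₂.le, hlt⟩).ne'

/-- A regular ball of the Hadamard material is determined by its central density. -/
theorem IsRegularElasticBall.unique (hlam : 0 < lam) (hmu : 0 ≤ mu)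
    (h₁ : IsRegularElasticBall K (hadamardRad lam mu) (hadamardTan lam mu) ρ₁ prad₁ ptan₁ R₁)
    (h₂ : IsRegularElasticBall K (hadamardRad lam mu) (hadamardTan lam mu) ρ₂ prad₂ ptan₂ R₂)
    (h0 : ρ₁ 0 = ρ₂ 0) (hcrit : ρ₂ 0 / K < criticalDensity lam mu) :
    R₁ = R₂ ∧ EqOn ρ₁ ρ₂ (Ici 0) ∧ EqOn prad₁ prad₂ (Ici 0) ∧ EqOn ptan₁ ptan₂ (Ici 0) := by
  have hR : R₁ = R₂ := le_antisymm (h₁.radius_le hlam hmu h₂ h0 hcrit)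
    (h₂.radius_le hlam hmu h₁ h0.symm (h0 ▸ hcrit))
  subst hR
  have hK := h₁.2.refDensity_pos
  have hRp := h₁.1.radius_pos
  have heq := h₁.eqOn_Ioc hlam hmu h₂ h0 hcrit le_rfl
  have hρ : ∀ r ∈ Ioc 0 R₁, ρ₁ r = ρ₂ r := fun r hr => (div_left_inj' hK.ne').1 (heq r hr).1
  have hpos : ∀ r ∈ Ioc 0 R₁, 0 < ρ₂ r := by
    intro r hr
    rcases hr.2.lt_or_eq with hlt | rfl
    · exact h₂.1.rho_pos r ⟨hr.1, hlt⟩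
    · exact h₂.rho_boundary_pos hlam hmu hcrit
  have hrad : ∀ r ∈ Ioc 0 R₁, prad₁ r = prad₂ r := fun r hr => by
    rw [h₁.prad_eq hr (by rw [hρ r hr]; exact hpos r hr), h₂.prad_eq hr (hpos r hr),
      (heq r hr).1, (heq r hr).2]
  have htan : ∀ r ∈ Ioc 0 R₁, ptan₁ r = ptan₂ r := fun r hr => by
    rw [h₁.ptan_eq hr (by rw [hρ r hr]; exact hpos r hr), h₂.ptan_eq hr (hpos r hr),
      (heq r hr).1, (heq r hr).2]
  -- The material law is imposed only for `r > 0`, so the central pressures are compared through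
  -- limits.
  have hrad0 : prad₁ 0 = prad₂ 0 := by
    refine tendsto_nhds_unique ((tendsto_center hRp h₁.1.cont_prad).congr' ?_)
      (tendsto_center hRp h₂.1.cont_prad)
    filter_upwards [h₁.1.eventually_mem] with r hr using hrad r (Ioo_subset_Ioc_self hr)
  have hglue {f g : ℝ → ℝ} (hc : f 0 = g 0) (hi : ∀ r ∈ Ioc 0 R₁, f r = g r)
      (hf : ∀ r, R₁ < r → f r = 0) (hg : ∀ r, R₁ < r → g r = 0) : EqOn f g (Ici 0) := by
    intro r hr
    rcases (mem_Ici.1 hr).eq_or_lt with rfl | h0r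
    · exact hc
    rcases le_or_gt r R₁ with hle | hgt
    · exact hi r ⟨h0r, hle⟩
    · rw [hf r hgt, hg r hgt]
  refine ⟨rfl, hglue h0 hρ h₁.1.rho_vacuum h₂.1.rho_vacuum,
    hglue hrad0 hrad h₁.1.prad_vacuum h₂.1.prad_vacuum,
    hglue ?_ htan h₁.1.ptan_vacuum h₂.1.ptan_vacuum⟩
  rw [← h₁.1.isotropic_center, ← h₂.1.isotropic_center, hrad0]

end Uniqueness

/-! ### Construction of the ball. -/

section Existence

variable {lam mu κ δc R : ℝ} {v D : ℝ → ℝ}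

/-- The profiles `(δ, η)` determined by `v` solve the structure equations on `[0, R]` and the
radial pressure vanishes first at `R`. -/
structure IsBallProfile (lam mu κ δc R : ℝ) (v D : ℝ → ℝ) : Prop where
  continuous : Continuous v
  continuous_deriv : Continuous D
  deriv_zero : D 0 = 0
  radius_pos : 0 < R
  hasDerivAt : ∀ r ∈ Icc 0 R, HasDerivAt (densityOf δc v) (D r) r
  deriv_eq : ∀ r ∈ Ioc 0 R, D r =
    -(shearCoeff lam mu (densityOf δc v r) (meanOf δc v r)
        * (densityOf δc v r - meanOf δc v r) / r)
      - r * gravityCoeff lam mu κ (densityOf δc v r) (meanOf δc v r)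
  density_pos : ∀ r ∈ Icc 0 R, 0 < densityOf δc v r
  density_lt_mean : ∀ r ∈ Ioc 0 R, densityOf δc v r < meanOf δc v r
  one_lt_mean : ∀ r ∈ Icc 0 R, 1 < meanOf δc v r
  mean_lt : ∀ r ∈ Ioc 0 R, meanOf δc v r < δc
  pressure_pos : ∀ r ∈ Ico 0 R, 0 < radPressure lam mu (densityOf δc v r) (meanOf δc v r)
  pressure_boundary : radPressure lam mu (densityOf δc v R) (meanOf δc v R) = 0

/-- Continuity of `v` suffices: the difference quotient of `r² v` at 0 is `t v(t)`. -/
lemma hasDerivAt_densityOf_zero (hv : Continuous v) : HasDerivAt (densityOf δc v) 0 0 := by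
  have h1 : HasDerivAt (fun r => r ^ 2 * v r) 0 0 := by
    rw [hasDerivAt_iff_tendsto_slope_zero]
    have : Tendsto (fun t => t * v t) (𝓝[≠] 0) (𝓝 0) := by
      have hc : Continuous fun t => t * v t := by fun_prop
      have := (hc.tendsto 0).mono_left (nhdsWithin_le_nhds (s := {0}ᶜ))
      simpa using this
    refine this.congr' ?_
    filter_upwards [self_mem_nhdsWithin] with t ht
    have ht' : t ≠ 0 := ht
    simp only [zero_add, smul_eq_mul]
    field_simp
    ring
  have h2 := (hasDerivAt_meanOf (δc := δc) hv 0).add h1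
  simp only [zero_mul, mul_zero, add_zero] at h2
  exact h2

lemma meanOf_lt (hv : Continuous v) {T : ℝ} (hneg : ∀ r ∈ Ioc 0 T, v r < 0) :
    ∀ r ∈ Ioc 0 T, meanOf δc v r < δc := by
  have hanti : StrictAntiOn (meanOf δc v) (Icc 0 T) := by
    refine strictAntiOn_of_deriv_neg (convex_Icc 0 T) (continuous_meanOf hv).continuousOn ?_
    rw [interior_Icc]
    intro r hr
    rw [(hasDerivAt_meanOf hv r).deriv]
    have := mul_neg_of_pos_of_neg hr.1 (hneg r (Ioo_subset_Ioc_self hr))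
    linarith
  intro r hr
  have := hanti ⟨le_rfl, hr.1.le.trans hr.2⟩ (Ioc_subset_Icc_self hr) hr.1
  rwa [meanOf_zero] at this

lemma continuous_apply_pair {G : ℝ → ℝ → ℝ} (hG : Continuous fun p : ℝ × ℝ => G p.1 p.2)
    {f g : ℝ → ℝ} (hf : Continuous f) (hg : Continuous g) : Continuous fun r => G (f r) (g r) :=
  hG.comp (hf.prodMk hg)

/-- Turns `δ' ≤ -C r` into a quadratic drop, which makes `δ` negative at a finite radius. -/
lemma add_sq_le_of_deriv_le {f f' : ℝ → ℝ} {T C : ℝ} (hT : 0 ≤ T) (hf : ContinuousOn f (Icc 0 T))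
    (hd : ∀ r ∈ Ioo 0 T, HasDerivAt f (f' r) r) (hle : ∀ r ∈ Ioo 0 T, f' r ≤ -(r * C)) :
    f T + C / 2 * T ^ 2 ≤ f 0 := by
  have hd' : ∀ r ∈ Ioo 0 T, HasDerivAt (fun r => f r + C / 2 * r ^ 2)
      (f' r + C / 2 * ((2 : ℕ) * r ^ (2 - 1))) r := fun r hr =>
    (hd r hr).add ((hasDerivAt_pow 2 r).const_mul (C / 2))
  have hcont : ContinuousOn (fun r => f r + C / 2 * r ^ 2) (Icc 0 T) :=
    hf.add (by fun_prop)
  have hanti : AntitoneOn (fun r => f r + C / 2 * r ^ 2) (Icc 0 T) := by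
    refine antitoneOn_of_deriv_nonpos (convex_Icc 0 T) hcont ?_ ?_
    · rw [interior_Icc]
      exact fun r hr => (hd' r hr).differentiableAt.differentiableWithinAt
    · rw [interior_Icc]
      intro r hr
      rw [(hd' r hr).deriv]
      have := hle r hr
      norm_num
      linarith
  have := hanti ⟨le_rfl, hT⟩ ⟨hT, le_rfl⟩ hT
  simpa using this

/-- Solution of the truncated structure equations up to a radius where `δ` is negative. -/
theorem exists_truncated_profile (hlam : 0 < lam) (hmu : 0 ≤ mu) (hκ : 0 < κ) (h1 : 1 < δc)
    (hc : δc < criticalDensity lam mu) :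
    ∃ (T : ℝ) (v D : ℝ → ℝ), 0 < T ∧ Continuous v ∧ Continuous D ∧ D 0 = 0 ∧
      (∀ r ∈ Ioc 0 T, v r < 0) ∧
      (∀ r ∈ Ico 0 T, HasDerivAt (densityOf δc v) (D r) r) ∧
      (∀ r, D r = -(r * (clampedShear lam mu δc (densityOf δc v r) (meanOf δc v r) * v r
        + clampedGravity lam mu κ δc (densityOf δc v r) (meanOf δc v r)))) ∧
      densityOf δc v T < 0 := by
  obtain ⟨L, Fm, FM, hL, hFm, hF, hBL, hFL⟩ := exists_clamped_bounds hlam hmu hκ h1 hc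
  have hδc : 0 < δc := by linarith
  -- Since `T ≥ 1` and `Fm T = 2δc + Fm`, the drop `Fm T²/2` exceeds `δc`.
  obtain ⟨T, hT⟩ : ∃ T, T = 2 * δc / Fm + 1 := ⟨_, rfl⟩
  have hT0 : 0 < T := by rw [hT]; positivity
  have hBc := continuous_of_lipschitz_bound hBL
  have hFc := continuous_of_lipschitz_bound hFL
  obtain ⟨v, hv, hneg, hder⟩ := exists_profile (δc := δc) hT0 hL hFm hBc hFc
    clampedShear_mem hF hBL hFL
  set δ := densityOf δc v with hδ
  set η := meanOf δc v with hη
  set B : ℝ → ℝ := fun r => clampedShear lam mu δc (δ r) (η r) with hB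
  set F : ℝ → ℝ := fun r => clampedGravity lam mu κ δc (δ r) (η r) with hFdef
  set D : ℝ → ℝ := fun r => -(r * (B r * v r + F r)) with hD
  have hδcont : Continuous δ := continuous_densityOf hv
  have hηcont : Continuous η := continuous_meanOf hv
  have hBcont : Continuous B := continuous_apply_pair (G := clampedShear lam mu δc) hBc hδcont hηcont
  have hFcont : Continuous F := 
    continuous_apply_pair (G := clampedGravity lam mu κ δc) hFc hδcont hηcont
  have hDcont : Continuous D := (continuous_id.mul ((hBcont.mul hv).add hFcont)).neg
  have hD0 : D 0 = 0 := by simp [hD]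
  have hderD : ∀ r ∈ Ico 0 T, HasDerivAt δ (D r) r := by
    intro r hr
    rcases hr.1.eq_or_lt with rfl | h0
    · rw [hD0]; exact hasDerivAt_densityOf_zero hv
    · exact hder r ⟨h0, hr.2⟩
  have hDle : ∀ r ∈ Ioo 0 T, D r ≤ -(r * Fm) := by
    intro r hr
    have hb := (clampedShear_mem (lam := lam) (mu := mu) (δc := δc) (δ r) (η r)).2
    have hf := (hF (δ r) (η r)).1
    have hvr := (hneg r (Ioo_subset_Ioc_self hr)).le
    have hbv := mul_nonneg_of_nonpos_of_nonpos hb hvr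
    have : r * Fm ≤ r * (B r * v r + F r) :=
      mul_le_mul_of_nonneg_left (by simp only [hB, hFdef]; linarith) hr.1.le
    simp only [hD]
    linarith
  have hδT : δ T < 0 := by
    have h2 := add_sq_le_of_deriv_le hT0.le hδcont.continuousOn
      (fun r hr => hderD r (Ioo_subset_Ico_self hr)) hDle
    simp only [hδ, densityOf_zero] at h2
    have h3 : 1 ≤ T := by
      have : 0 ≤ 2 * δc / Fm := by positivity
      linarith
    have h4 : Fm * T = 2 * δc + Fm := by rw [hT]; field_simp
    nlinarith
  exact ⟨T, v, D, hT0, hv, hDcont, hD0, hneg, hderD, fun _ => rfl, hδT⟩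

/-- The radius is the first zero of the truncated pressure. Nonnegativity of that pressure on `[0,
R]` bounds `δ` and `η` from below, while `v < 0` gives `δ < η < δc` for `r > 0`; hence the
truncations act trivially and the original equations hold. -/
theorem exists_isBallProfile (hlam : 0 < lam) (hmu : 0 ≤ mu) (hκ : 0 < κ) (h1 : 1 < δc)
    (hc : δc < criticalDensity lam mu) :
    ∃ R v D, IsBallProfile lam mu κ δc R v D := by
  obtain ⟨T, v, D, hT0, hv, hDcont, hD0, hneg, hderD, hDeq, hδT⟩ :=
    exists_truncated_profile hlam hmu hκ h1 hc
  have hδc : 0 < δc := by linarith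
  set δ := densityOf δc v with hδ
  set η := meanOf δc v with hη
  have hδcont : Continuous δ := continuous_densityOf hv
  have hηcont : Continuous η := continuous_meanOf hv
  have hcc : 0 < lam + 2 * mu := by positivity
  -- This is `δ · p_rad` with `η` truncated; unlike `p_rad` it is continuous also where `δ ≤ 0`.
  set P : ℝ → ℝ := fun r => (lam + 2 * mu) * δ r - radProfile lam mu (clamp 1 δc (η r)) with hP
  have hcl (r : ℝ) := clamp_mem h1.le (η r)
  have hh (r : ℝ) : lam + mu < radProfile lam mu (clamp 1 δc (η r)) :=
    lt_radProfile hlam hmu (hcl r).1 ((hcl r).2.trans_lt hc)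
  have hPcont : Continuous P := by
    refine (continuous_const.mul hδcont).sub ?_
    rw [continuous_iff_continuousAt]
    intro r
    exact (contDiffAt_radProfile (by linarith [(hcl r).1])).continuousAt.comp_of_eq
      ((continuous_clamp 1 δc).comp hηcont).continuousAt rfl
  have hP0 : 0 < P 0 := by
    simp only [hP, hδ, hη, densityOf_zero, meanOf_zero]
    rw [clamp_of_mem ⟨h1.le, le_rfl⟩, sub_pos]
    exact (radProfile_lt_iff hlam hmu hδc).2 h1
  have hPT : P T < 0 := by
    have := hh T
    have := mul_neg_of_pos_of_neg hcc hδT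
    simp only [hP]
    linarith
  have hcompact : IsCompact (Icc 0 T ∩ P ⁻¹' Iic 0) :=
    isCompact_Icc.inter_right (isClosed_Iic.preimage hPcont)
  obtain ⟨R, hRm, hmin⟩ := hcompact.exists_isLeast ⟨T, ⟨hT0.le, le_rfl⟩, hPT.le⟩
  have hR0 : 0 < R := by
    refine hRm.1.1.lt_of_ne fun h => ?_
    have : P R ≤ 0 := hRm.2
    rw [← h] at this
    linarith
  have hPpos : ∀ r ∈ Ico 0 R, 0 < P r := by
    intro r hr
    by_contra! hle
    exact absurd (hmin ⟨⟨hr.1, hr.2.le.trans hRm.1.2⟩, hle⟩) (not_le.2 hr.2)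
  have hPR : P R = 0 := by
    refine le_antisymm hRm.2 ?_
    refine ge_of_tendsto ((hPcont.tendsto R).mono_left (nhdsWithin_le_nhds (s := Iio R))) ?_
    filter_upwards [Ioo_mem_nhdsLT hR0] with r hr using (hPpos r ⟨hr.1.le, hr.2⟩).le
  have hRT : R < T := by
    refine hRm.1.2.lt_of_ne fun h => ?_
    rw [h] at hPR
    linarith
  have hPnn : ∀ r ∈ Icc 0 R, 0 ≤ P r := by
    intro r hr
    rcases hr.2.lt_or_eq with h | rfl
    · exact (hPpos r ⟨hr.1, h⟩).le
    · exact hPR.ge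
  have hdens : ∀ r ∈ Icc 0 R, minDensity lam mu < δ r := by
    intro r hr
    have a1 := hPnn r hr
    have a2 := hh r
    simp only [hP] at a1
    unfold minDensity
    rw [div_lt_iff₀ hcc]
    linarith
  have hlt : ∀ r ∈ Ioc 0 R, δ r < η r := by
    intro r hr
    have := mul_neg_of_pos_of_neg (pow_pos hr.1 2) (hneg r ⟨hr.1, hr.2.trans hRT.le⟩)
    change η r + r ^ 2 * v r < η r
    linarith
  have hηlt : ∀ r ∈ Ioc 0 R, η r < δc := fun r hr =>
    meanOf_lt hv hneg r ⟨hr.1, hr.2.trans hRT.le⟩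
  have hone : ∀ r ∈ Icc 0 R, 1 < η r := by
    intro r hr
    rcases hr.1.eq_or_lt with rfl | h0
    · rw [hη, meanOf_zero]; exact h1
    have a1 := hPnn r hr
    have a2 := hlt r ⟨h0, hr.2⟩
    have a3 := hηlt r ⟨h0, hr.2⟩
    simp only [hP] at a1
    by_contra! hle
    -- If `η ≤ 1`, the truncated value is 1 and `h(1) = λ + 2μ`, so `δ < η ≤ 1` would make `P`
    -- negative.
    have a4 : clamp 1 δc (η r) = 1 := by
      rw [clamp, min_eq_right a3.le, max_eq_left hle]
    rw [a4, radProfile_one] at a1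
    have a5 : (lam + 2 * mu) * δ r < (lam + 2 * mu) * 1 :=
      mul_lt_mul_of_pos_left (a2.trans_le hle) hcc
    linarith
  have hηle : ∀ r ∈ Icc 0 R, η r ≤ δc := by
    intro r hr
    rcases hr.1.eq_or_lt with rfl | h0
    · rw [hη, meanOf_zero]
    · exact (hηlt r ⟨h0, hr.2⟩).le
  have hPeq : ∀ r ∈ Icc 0 R, P r = (lam + 2 * mu) * δ r - radProfile lam mu (η r) := by
    intro r hr
    simp only [hP]
    rw [clamp_of_mem ⟨(hone r hr).le, hηle r hr⟩]
  have hpos : ∀ r ∈ Icc 0 R, 0 < δ r := fun r hr => (minDensity_pos hlam hmu).trans (hdens r hr)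
  have hpress : ∀ r ∈ Icc 0 R, radPressure lam mu (δ r) (η r) = P r / δ r := by
    intro r hr
    have := (hpos r hr).ne'
    rw [hPeq r hr, radPressure]
    field_simp
  refine ⟨R, v, D, hv, hDcont, hD0, hR0, fun r hr => hderD r ⟨hr.1, hr.2.trans_lt hRT⟩, ?_, hpos,
    hlt, hone, hηlt, fun r hr => ?_, ?_⟩
  · intro r hr
    have hr' := Ioc_subset_Icc_self hr
    have m1 : δ r ∈ Icc (minDensity lam mu) δc :=
      ⟨(hdens r hr').le, (hlt r hr).le.trans (hηle r hr')⟩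
    have m2 : η r ∈ Icc 1 δc := ⟨(hone r hr').le, hηle r hr'⟩
    have hr0 := hr.1.ne'
    have e1 : δ r - η r = r ^ 2 * v r := by
      change η r + r ^ 2 * v r - η r = _; ring
    rw [← hδ, ← hη, e1, ← clampedShear_eq hlam hmu hc m1 m2 (hlt r hr).le,
      ← clampedGravity_eq (κ := κ) m1 m2]
    rw [hDeq]
    field_simp
    ring
  · rw [← hδ, ← hη, hpress r ⟨hr.1, hr.2.le⟩]
    exact div_pos (hPpos r hr) (hpos r ⟨hr.1, hr.2.le⟩)
  · rw [← hδ, ← hη, hpress R ⟨hR0.le, le_rfl⟩, hPR, zero_div]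

/-- Quantities depending smoothly on `(δ, η)`, set to zero outside the ball. -/
def ballField (δc R : ℝ) (v : ℝ → ℝ) (Q : ℝ → ℝ → ℝ) (r : ℝ) : ℝ :=
  if r ≤ R then Q (densityOf δc v r) (meanOf δc v r) else 0

lemma ballField_of_le {Q : ℝ → ℝ → ℝ} {r : ℝ} (hr : r ≤ R) :
    ballField δc R v Q r = Q (densityOf δc v r) (meanOf δc v r) := if_pos hr

lemma ballField_of_lt {Q : ℝ → ℝ → ℝ} {r : ℝ} (hr : R < r) : ballField δc R v Q r = 0 :=
  if_neg (not_le.2 hr)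

lemma contDiffOn_one_of_hasDerivAt {f f' : ℝ → ℝ} (hR : 0 < R)
    (hf : ∀ r ∈ Icc 0 R, HasDerivAt f (f' r) r) (hf' : ContinuousOn f' (Icc 0 R)) :
    ContDiffOn ℝ 1 f (Icc 0 R) := by
  have hu := uniqueDiffOn_Icc hR
  rw [contDiffOn_one_iff_derivWithin hu]
  exact ⟨fun r hr => (hf r hr).differentiableAt.differentiableWithinAt,
    hf'.congr fun r hr => (hf r hr).hasDerivWithinAt.derivWithin (hu r hr)⟩

lemma IsBallProfile.contDiffOn_ballField (h : IsBallProfile lam mu κ δc R v D) {Q : ℝ → ℝ → ℝ}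
    (hQ : ∀ q : ℝ × ℝ, 0 < q.1 → 0 < q.2 → ContDiffAt ℝ 1 (fun q : ℝ × ℝ => Q q.1 q.2) q) :
    ContDiffOn ℝ 1 (ballField δc R v Q) (Icc 0 R) := by
  have hδ := contDiffOn_one_of_hasDerivAt h.radius_pos h.hasDerivAt h.continuous_deriv.continuousOn
  have hη : ContDiffOn ℝ 1 (meanOf δc v) (Icc 0 R) :=
    contDiffOn_one_of_hasDerivAt h.radius_pos
      (fun r _ => hasDerivAt_meanOf h.continuous r)
      (continuous_const.mul (continuous_id.mul h.continuous)).continuousOn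
  have hcomp : ContDiffOn ℝ 1 (fun r => Q (densityOf δc v r) (meanOf δc v r)) (Icc 0 R) :=
    fun r hr => ContDiffAt.comp_contDiffWithinAt (f := fun r => (densityOf δc v r, meanOf δc v r)) r
      (hQ (densityOf δc v r, meanOf δc v r) (h.density_pos r hr)
      (zero_lt_one.trans (h.one_lt_mean r hr))) ((hδ r hr).prodMk (hη r hr))
  exact hcomp.congr fun r hr => ballField_of_le hr.2

/-- Both `δ'` and `η'` vanish at the center, so by the chain rule the derivative of `Q(δ, η)` does
too; `C¹` regularity on the closed interval turns this into a limit. -/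
lemma IsBallProfile.tendsto_deriv_ballField (h : IsBallProfile lam mu κ δc R v D)
    {Q : ℝ → ℝ → ℝ}
    (hQ : ∀ q : ℝ × ℝ, 0 < q.1 → 0 < q.2 → ContDiffAt ℝ 1 (fun q : ℝ × ℝ => Q q.1 q.2) q) :
    Tendsto (deriv (ballField δc R v Q)) (𝓝[>] 0) (𝓝 0) := by
  have hR := h.radius_pos
  have h0 : (0 : ℝ) ∈ Icc 0 R := ⟨le_rfl, hR.le⟩
  have hu := uniqueDiffOn_Icc hR
  have hcd := h.contDiffOn_ballField hQ
  have hcont := ((contDiffOn_one_iff_derivWithin hu).1 hcd).2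
  have hzero : derivWithin (ballField δc R v Q) (Icc 0 R) 0 = 0 := by
    have hq := ((hQ (densityOf δc v 0, meanOf δc v 0) (h.density_pos 0 h0)
      (zero_lt_one.trans (h.one_lt_mean 0 h0))).differentiableAt (by norm_num)).hasFDerivAt
    have hγ := (h.hasDerivAt 0 h0).prodMk (hasDerivAt_meanOf (δc := δc) h.continuous 0)
    have hc := hq.comp_hasDerivAt (0 : ℝ) hγ
    rw [h.deriv_zero, zero_mul, mul_zero, Prod.mk_zero_zero, map_zero] at hc
    have hc' := hc.hasDerivWithinAt (s := Icc 0 R)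
    exact (hc'.congr (fun r hr => ballField_of_le hr.2) (ballField_of_le hR.le)).derivWithin
      (hu 0 h0)
  have ht := tendsto_center hR hcont
  rw [hzero] at ht
  refine ht.congr' ?_
  filter_upwards [Ioo_mem_nhdsGT hR] with r hr
  exact derivWithin_of_mem_nhds (Icc_mem_nhds hr.1 hr.2)

/-- The relation `(s³ η)' = 3 s² δ` identifies `meanOf` with the mean of the constructed density. -/
lemma IsBallProfile.meanRelDensity_eq (h : IsBallProfile lam mu κ δc R v D) {K : ℝ} (hK : 0 < K)
    {r : ℝ} (hr : r ∈ Ioc 0 R) :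
    meanRelDensity K (ballField δc R v fun d _ => K * d) r = meanOf δc v r := by
  have hv := h.continuous
  have hcont := continuous_densityOf (δc := δc) hv
  have e1 : EqOn (ballField δc R v fun d _ => K * d) (fun s => K * densityOf δc v s) (Icc 0 R) :=
    fun s hs => ballField_of_le hs.2
  rw [meanRelDensity_congr e1 (Ioc_subset_Icc_self hr)]
  have hi : ∫ s in (0 : ℝ)..r, K * densityOf δc v s * s ^ 2 = K * (r ^ 3 * meanOf δc v r / 3) := by
    have hd : ∀ s ∈ uIcc 0 r, HasDerivAt (fun s => K * (s ^ 3 * meanOf δc v s / 3))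
        (K * densityOf δc v s * s ^ 2) s := by
      intro s _
      refine ((((hasDerivAt_pow 3 s).mul (hasDerivAt_meanOf hv s)).div_const 3).const_mul
        K).congr_deriv ?_
      unfold densityOf
      push_cast
      ring
    rw [intervalIntegral.integral_eq_sub_of_hasDerivAt hd
      (Continuous.intervalIntegrable (by fun_prop) _ _)]
    ring
  unfold meanRelDensity enclosedMass
  rw [hi]
  have := hr.1
  have := Real.pi_pos
  field_simp

lemma ballField_relDensity {K : ℝ} (hK : 0 < K) {r : ℝ} (hr : r ≤ R) :
    relDensity K (ballField δc R v fun d _ => K * d) r = densityOf δc v r := by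
  rw [relDensity, ballField_of_le hr]
  field_simp

theorem IsBallProfile.isStronglyRegularElasticBall {K : ℝ} (hlam : 0 < lam) (hmu : 0 ≤ mu)
    (hK : 0 < K) (hc : δc < criticalDensity lam mu)
    (h : IsBallProfile lam mu (4 * Real.pi / 3 * K ^ 2) δc R v D) :
    IsStronglyRegularElasticBall K (hadamardRad lam mu) (hadamardTan lam mu)
      (ballField δc R v fun d _ => K * d) (ballField δc R v (radPressure lam mu))
      (ballField δc R v (tanPressure lam mu)) R := by
  have hR := h.radius_pos
  set ρ := ballField δc R v fun d _ => K * d with hρ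
  have hρpos : ∀ r ∈ Icc 0 R, 0 < ρ r := fun r hr => by
    rw [hρ, ballField_of_le hr.2]
    exact mul_pos hK (h.density_pos r hr)
  have hηpos : ∀ r ∈ Icc 0 R, 0 < meanOf δc v r := fun r hr =>
    zero_lt_one.trans (h.one_lt_mean r hr)
  have hQρ : ∀ q : ℝ × ℝ, 0 < q.1 → 0 < q.2 →
      ContDiffAt ℝ 1 (fun q : ℝ × ℝ => (fun d (_ : ℝ) => K * d) q.1 q.2) q :=
    fun q _ _ => contDiffAt_const.mul contDiffAt_fst
  have c1 : ContDiffOn ℝ 1 ρ (Icc 0 R) := h.contDiffOn_ballField hQρ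
  have c2 := h.contDiffOn_ballField (Q := radPressure lam mu) fun _ => contDiffAt_radPressure
  have c3 := h.contDiffOn_ballField (Q := tanPressure lam mu) fun _ => contDiffAt_tanPressure
  have hle : ∀ r, 0 < ρ r → r ≤ R := fun r hr => by
    by_contra! hlt
    rw [hρ, ballField_of_lt hlt] at hr
    exact lt_irrefl _ hr
  have hppos : ∀ r ∈ Ico 0 R, 0 < radPressure lam mu (densityOf δc v r) (meanOf δc v r) :=
    h.pressure_pos
  have htan : ∀ r ∈ Ico 0 R, 0 < tanPressure lam mu (densityOf δc v r) (meanOf δc v r) := by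
    intro r hr
    have hrI := Ico_subset_Icc_self hr
    rcases hr.1.eq_or_lt with rfl | h0
    · have := hppos 0 hr
      simp only [densityOf_zero, meanOf_zero] at this ⊢
      rw [tanPressure_self (by simpa using hηpos 0 hrI)]
      exact this
    · have hr' : r ∈ Ioc 0 R := ⟨h0, hr.2.le⟩
      have a1 := h.density_pos r hrI
      have a2 := h.density_lt_mean r hr'
      have a3 := shearProfile_pos hlam hmu (hηpos r hrI) ((h.mean_lt r hr').trans hc)
      -- For `δ < η` the tangential pressure is at least the radial one, because `g > 0`.
      have a4 : 0 ≤ 1 / densityOf δc v r - densityOf δc v r / meanOf δc v r ^ 2 := by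
        have := hηpos r hrI
        rw [sub_nonneg, div_le_div_iff₀ (by positivity) a1]
        nlinarith
      have := hppos r hr
      unfold tanPressure
      have := mul_nonneg a3.le a4
      linarith
  refine ⟨⟨⟨hR, ?_, c1.continuousOn, c2.continuousOn, c3.continuousOn,
    c1.mono Ioc_subset_Icc_self, c2.mono Ioc_subset_Icc_self, c3.mono Ioc_subset_Icc_self, ?_,
    fun r hr => ?_, fun r hr => ?_, ?_, ?_, fun _ => ballField_of_lt, fun _ => ballField_of_lt,
    fun _ => ballField_of_lt⟩, c1, c2, c3, h.tendsto_deriv_ballField hQρ,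
    h.tendsto_deriv_ballField fun _ => contDiffAt_radPressure,
    h.tendsto_deriv_ballField fun _ => contDiffAt_tanPressure⟩,
    ⟨hK, contDiffOn_hadamardRad, contDiffOn_hadamardTan, fun r h0 hr => ?_, fun r h0 hr => ?_⟩⟩
  · have : {r : ℝ | 0 < r ∧ 0 < ρ r} = Ioc 0 R := by
      ext r
      exact ⟨fun hr => ⟨hr.1, hle r hr.2⟩, fun hr => ⟨hr.1, hρpos r (Ioc_subset_Icc_self hr)⟩⟩
    rw [this, interior_Ioc]
  · intro r hr
    have hrI := Ioo_subset_Icc_self hr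
    have hr' := Ioo_subset_Ioc_self hr
    have a1 := h.density_pos r hrI
    have a2 := hηpos r hrI
    have a3 := radProfile_pos hlam hmu a2 ((h.mean_lt r hr').trans hc)
    have hr0 := hr.1.ne'
    have hmean : HasDerivAt (meanOf δc v) (3 * (densityOf δc v r - meanOf δc v r) / r) r := by
      refine (hasDerivAt_meanOf h.continuous r).congr_deriv ?_
      unfold densityOf
      field_simp
      ring
    have hP := hasDerivAt_radPressure_comp (lam := lam) (mu := mu) a1 a2 (h.hasDerivAt r hrI) hmean
    rw [(equilibrium_iff hr.1 a1 a2 a3).2 (h.deriv_eq r hr')] at hP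
    refine (hP.congr_of_eventuallyEq ?_).congr_deriv ?_
    · filter_upwards [Ioo_mem_nhds hr.1 hr.2] with s hs using ballField_of_le hs.2.le
    · rw [ballField_of_le hr.2.le, ballField_of_le hr.2.le, enclosedMass_eq_mean hK hr.1, hρ,
        h.meanRelDensity_eq hK hr', ballField_of_le hr.2.le]
      field_simp
  · rw [ballField_of_le hr.2.le]; exact hppos r hr
  · rw [ballField_of_le hr.2.le]; exact htan r hr
  · rw [ballField_of_le le_rfl]; exact h.pressure_boundary
  · rw [ballField_of_le hR.le, ballField_of_le hR.le, densityOf_zero, meanOf_zero,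
      tanPressure_self (by simpa using hηpos 0 ⟨le_rfl, hR.le⟩)]
  · have hrR := hle r hr
    have hrI : r ∈ Icc 0 R := ⟨h0.le, hrR⟩
    rw [ballField_of_le hrR, hρ, ballField_relDensity hK hrR, h.meanRelDensity_eq hK ⟨h0, hrR⟩,
      hadamardRad_eq (h.density_pos r hrI) (hηpos r hrI)]
  · have hrR := hle r hr
    have hrI : r ∈ Icc 0 R := ⟨h0.le, hrR⟩
    rw [ballField_of_le hrR, hρ, ballField_relDensity hK hrR, h.meanRelDensity_eq hK ⟨h0, hrR⟩,
      hadamardTan_eq (h.density_pos r hrI) (hηpos r hrI)]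

end Existence

end

/-! ### The main result. -/

theorem theorem6 (lam mu : ℝ) (hlam : 0 < lam) (hmu : 0 ≤ mu) :
    (∀ (K R : ℝ) (ρ prad ptan : ℝ → ℝ),
      IsRegularElasticBall K (hadamardRad lam mu) (hadamardTan lam mu) ρ prad ptan R →
        1 < ρ 0 / K) ∧
    (∀ K ρc : ℝ, 0 < K → 1 < ρc / K → ρc / K < ((lam + mu) / lam) ^ (3 / 2 : ℝ) →
      0 < deriv (fun d => hadamardRad lam mu d (ρc / K)) (ρc / K) ∧
      ∃ (ρ prad ptan : ℝ → ℝ) (R : ℝ),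
        IsStronglyRegularElasticBall K (hadamardRad lam mu) (hadamardTan lam mu)
          ρ prad ptan R ∧
        ρ 0 = ρc ∧
        (∀ r ∈ Ioc 0 R,
          0 < ρ r ∧
          0 < deriv (fun d => hadamardRad lam mu d (meanRelDensity K ρ r))
            (relDensity K ρ r) ∧
          ρ r < ρc ∧
          4 * Real.pi / 3 * max (ρ r) K * r ^ 3 < enclosedMass ρ r ∧
          enclosedMass ρ r < 4 * Real.pi / 3 * ρc * r ^ 3) ∧
        (∀ (ρ' prad' ptan' : ℝ → ℝ) (R' : ℝ),
          IsRegularElasticBall K (hadamardRad lam mu) (hadamardTan lam mu)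
            ρ' prad' ptan' R' →
          ρ' 0 = ρc →
            R' = R ∧ EqOn ρ' ρ (Ici 0) ∧ EqOn prad' prad (Ici 0) ∧
              EqOn ptan' ptan (Ici 0))) := by
  refine ⟨fun K R ρ prad ptan h => h.one_lt_central hlam hmu, fun K ρc hK h1 hcrit => ?_⟩
  have hδc : 0 < ρc / K := zero_lt_one.trans h1
  refine ⟨?_, ?_⟩
  · rw [(hasDerivAt_hadamardRad_fst hδc hδc).deriv]
    exact div_pos (radProfile_pos hlam hmu hδc hcrit) (pow_pos hδc 2)
  obtain ⟨R, v, D, hprof⟩ := exists_isBallProfile (κ := 4 * Real.pi / 3 * K ^ 2) hlam hmu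
    (by have := Real.pi_pos; positivity) h1 hcrit
  have hball := hprof.isStronglyRegularElasticBall hlam hmu hK hcrit
  set ρ := ballField (ρc / K) R v fun d _ => K * d with hρ
  have hρ0 : ρ 0 = ρc := by
    rw [hρ, ballField_of_le hprof.radius_pos.le, densityOf_zero]
    field_simp
  refine ⟨ρ, _, _, R, hball, hρ0, fun r hr => ?_, fun ρ' prad' ptan' R' h' h0 => ?_⟩
  · have hrI := Ioc_subset_Icc_self hr
    have a1 := hprof.density_pos r hrI
    have a2 := zero_lt_one.trans (hprof.one_lt_mean r hrI)
    have a3 := hprof.mean_lt r hr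
    have a4 := hprof.density_lt_mean r hr
    have hρr : ρ r = K * densityOf (ρc / K) v r := ballField_of_le hr.2
    have hr3 : 0 < r ^ 3 := pow_pos hr.1 3
    have hpi := Real.pi_pos
    have hKδ : K * (ρc / K) = ρc := by field_simp
    have hm : enclosedMass ρ r = 4 * Real.pi / 3 * (K * meanOf (ρc / K) v r) * r ^ 3 := by
      rw [enclosedMass_eq_mean hK hr.1, hρ, hprof.meanRelDensity_eq hK hr]
      ring
    refine ⟨?_, ?_, ?_, ?_, ?_⟩
    · rw [hρr]; exact mul_pos hK a1
    · rw [hρ, ballField_relDensity hK hr.2, hprof.meanRelDensity_eq hK hr,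
        (hasDerivAt_hadamardRad_fst a1 a2).deriv]
      exact div_pos (radProfile_pos hlam hmu a2 (a3.trans hcrit)) (pow_pos a1 2)
    · rw [hρr, ← hKδ]
      refine mul_lt_mul_of_pos_left ?_ hK
      rw [hKδ]
      exact a4.trans a3
    · rw [hm]
      have : max (ρ r) K < K * meanOf (ρc / K) v r := by
        refine max_lt ?_ (lt_mul_of_one_lt_right hK (hprof.one_lt_mean r hrI))
        rw [hρr]
        exact mul_lt_mul_of_pos_left a4 hK
      gcongr
    · rw [hm]
      have : K * meanOf (ρc / K) v r < ρc := by
        have := mul_lt_mul_of_pos_left a3 hK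
        rwa [hKδ] at this
      gcongr
  · exact h'.unique hlam hmu ⟨hball.1.toIsRegularBall, hball.2⟩ (h0.trans hρ0.symm)
      (by rw [hρ0]; exact hcrit)
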